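/- Let $K$ be a field extension of $\mathbb C$ and let $\theta\in K$ be either a positive real number or transcendental over $\mathbb C$ (a formal variable). Fix $N\ge 1$. For $1\le i\le N$ the Dunkl operator on $K[x_1,\dots,x_N]$ is $$\mathcal D_i=\frac{\partial}{\partial x_i}+\theta\sum_{j\ne i}\frac{1-(i,j)}{x_i-x_j},$$ where $(i,j)$ permutes the variables $x_i$ and $x_j$, and for $m\ge1$ the Heckman–Polychronakos operator is $\mathcal P_m=\sum_{i=1}^N (x_i\mathcal D_i)^m$. Jack polynomials are defined as follows. Let $\Lambda=K[p_1,p_2,\dots]$ be the ring of symmetric functions, $p_k$ being the power sums, with the bilinear form $\langle p_\mu,p_\nu\rangle=\delta_{\mu\nu}\,\theta^{-\ell(\mu)}\prod_{k\ge1}k^{a_k}a_k!$, where $\mu$ has $\ell(\mu)$ parts in all and $a_k$ parts equal to $k$. Let $m_\mu$ be the monomial symmetric functions and $\preceq$ the dominance order on partitions. For a partition $\lambda$ let $P_\lambda\in\Lambda$ be the symmetric function such that $P_\lambda-m_\lambda$ is a linear combination of the $m_\mu$ with $\mu\prec\lambda$ and $\langle P_\lambda,m_\mu\rangle=0$ for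 all $\mu\prec\lambda$. For $\lambda=(\lambda_1\ge\dots\ge\lambda_N\ge0)$ put $$J_\lambda(x_1,\dots,x_N;\theta)=\prod_{s\in\lambda}\bigl(\theta^{-1}a(s)+l(s)+1\bigr)\cdot P_\lambda(x_1,\dots,x_N,0,0,\dots),$$ where $a(s)$ and $l(s)$ are the arm and leg lengths of the box $s$ of the Young diagram of $\lambda$. For $r\ge1$ and $m\ge0$ let $h^{(r)}_m(x_1,\dots,x_N)$ be the sum of the complete homogeneous symmetric polynomials $h_m(x_{i_1},\dots,x_{i_r})$ over all $r$-element subsets $\{i_1,\dots,i_r\}$ of $\{1,\dots,N\}$, and let $h^{(r)}_m=0$ for $m<0$. **Theorem.** Let $\lambda_1\ge\dots\ge\lambda_N\ge0$ be integers and put $\ell_i=\lambda_i+\theta(N-i)$. Then $P_\lambda$ exists and is unique, $J_\lambda(x_1,\dots,x_N;\theta)\neq0$, and for every $m\ge1$ $$\mathcal P_m J_\lambda(x_1,\dots,x_N;\theta)=\mathrm{eig}_m(\lambda)\,J_\lambda(x_1,\dots,x_N;\theta),\qquad \mathrm{eig}_m(\lambda)=\sum_{r=1}^{N}(-\theta)^{r-1}h^{(r)}_{m+1-r}(\ell_1,\dots,\ell_N).$$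 Moreover $\mathrm{eig}_m(\lambda)=\mathbf 1^{T}U^m\mathbf 1$, where $\mathbf 1=(1,\dots,1)^T$ and $U$ is the upper triangular $N\times N$ matrix with diagonal entries $\ell_1,\dots,\ell_N$ and all entries above the diagonal equal to $-\theta$. -/

import Mathlib

noncomputable section

namespace HeckmanPolychronakos

open MvPolynomial

/-! ### Dunkl and Heckman–Polychronakos operators -/

theorem X_sub_X_dvd {K : Type*} [Field K] {N : ℕ} (i j : Fin N) (f : MvPolynomial (Fin N) K) :
    (X i - X j) ∣ f - rename (Equiv.swap i j) f := by
  have key : (Ideal.Quotient.mkₐ K (Ideal.span {(X i - X j : MvPolynomial (Fin N) K)})) =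
      (Ideal.Quotient.mkₐ K (Ideal.span {(X i - X j : MvPolynomial (Fin N) K)})).comp
        (rename (Equiv.swap i j)) := by
    have hij : Ideal.Quotient.mk (Ideal.span {(X i - X j : MvPolynomial (Fin N) K)}) (X i) =
        Ideal.Quotient.mk _ (X j) :=
      Ideal.Quotient.eq.2 (Ideal.mem_span_singleton_self _)
    apply MvPolynomial.algHom_ext
    intro k
    simp only [AlgHom.comp_apply, rename_X, Ideal.Quotient.mkₐ_eq_mk]
    rcases eq_or_ne k i with rfl | hi
    · rw [Equiv.swap_apply_left, hij]
    · rcases eq_or_ne k j with rfl | hj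
      · rw [Equiv.swap_apply_right, hij]
      · rw [Equiv.swap_apply_of_ne_of_ne hi hj]
  rw [← Ideal.mem_span_singleton, ← Ideal.Quotient.eq]
  exact congrArg (fun φ => φ f) key

theorem X_sub_X_ne_zero {K : Type*} [Field K] {N : ℕ} {i j : Fin N} (h : j ≠ i) :
    (X i - X j : MvPolynomial (Fin N) K) ≠ 0 :=
  sub_ne_zero.2 fun e => h (X_injective e).symm

/-- The operator `(1 - (i,j)) / (x_i - x_j)` on polynomials: the value at `f` is the unique
polynomial `q` with `f - (i,j) f = (x_i - x_j) q`. -/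
def diffQuot (K : Type*) [Field K] {N : ℕ} {i j : Fin N} (h : j ≠ i) :
    MvPolynomial (Fin N) K →ₗ[K] MvPolynomial (Fin N) K where
  toFun f := (X_sub_X_dvd i j f).choose
  map_add' f g := by
    apply mul_left_cancel₀ (X_sub_X_ne_zero (K := K) h)
    rw [mul_add, ← (X_sub_X_dvd i j (f + g)).choose_spec, ← (X_sub_X_dvd i j f).choose_spec,
      ← (X_sub_X_dvd i j g).choose_spec, map_add]
    ring
  map_smul' c f := by
    apply mul_left_cancel₀ (X_sub_X_ne_zero (K := K) h)
    rw [RingHom.id_apply, mul_smul_comm, ← (X_sub_X_dvd i j (c • f)).choose_spec,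
      ← (X_sub_X_dvd i j f).choose_spec, map_smul, smul_sub]

/-- The defining equation of `diffQuot`. -/
theorem mul_diffQuot {K : Type*} [Field K] {N : ℕ} {i j : Fin N} (h : j ≠ i)
    (f : MvPolynomial (Fin N) K) :
    (X i - X j) * diffQuot K h f = f - rename (Equiv.swap i j) f :=
  (X_sub_X_dvd i j f).choose_spec.symm

/-- The Dunkl operator `D_i = ∂/∂x_i + θ ∑_{j ≠ i} (1 - (i,j)) / (x_i - x_j)`. -/
def dunkl {K : Type*} [Field K] {N : ℕ} (θ : K) (i : Fin N) :
    Module.End K (MvPolynomial (Fin N) K) :=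
  (pderiv i).toLinearMap + θ • ∑ j : {j : Fin N // j ≠ i}, diffQuot K j.2

/-- The Heckman–Polychronakos operator `P_m = ∑_i (x_i D_i)^m`. -/
def hpOp {K : Type*} [Field K] (N : ℕ) (θ : K) (m : ℕ) :
    Module.End K (MvPolynomial (Fin N) K) :=
  ∑ i : Fin N, (LinearMap.mulLeft K (X i) * dunkl θ i) ^ m

/-! ### Symmetric functions

Over a field of characteristic zero the ring `Λ` of symmetric functions (in infinitely many
variables) is the polynomial ring in the power sums `p_1, p_2, …`. -/

/-- The ring of symmetric functions; the variable `X k` is the power sum `p_k`. -/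
abbrev SymFn (K : Type*) [Field K] : Type _ := MvPolynomial ℕ+ K

/-- The specialization `F ↦ F(x_1, …, x_N) = F(x_1, …, x_N, 0, 0, …)`. -/
def SymFn.toVars {K : Type*} [Field K] (N : ℕ) : SymFn K →ₐ[K] MvPolynomial (Fin N) K :=
  aeval fun k : ℕ+ => psum (Fin N) K (k : ℕ)

/-- The deformed Hall inner product, with `⟨p_μ, p_ν⟩ = 0` for `μ ≠ ν` and
`⟨p_μ, p_μ⟩ = z_μ α ^ ℓ(μ)`, where `α = 1/θ` and `z_μ = ∏_k k ^ {a_k} a_k !` for `μ` with `a_k`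
parts equal to `k`. -/
def hall {K : Type*} [Field K] (θ : K) (f g : SymFn K) : K :=
  ∑ a ∈ f.support, f.coeff a * g.coeff a *
    a.prod fun (k : ℕ+) (r : ℕ) => (((k : ℕ) : K) / θ) ^ r * (r.factorial : K)

/-! ### Jack polynomials -/

/-- The sum of the `k` largest parts of a partition. -/
def partialSum {n : ℕ} (μ : n.Partition) (k : ℕ) : ℕ :=
  ((μ.parts.sort (· ≥ ·)).take k).sum

/-- The dominance order on partitions of `n`: `μ ⪯ ν`. -/
def DomLE {n : ℕ} (μ ν : n.Partition) : Prop :=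
  ∀ k, partialSum μ k ≤ partialSum ν k

/-- `g` is the monomial symmetric function `m_μ`. -/
def IsMonomialSymm {K : Type*} [Field K] {n : ℕ} (μ : n.Partition) (g : SymFn K) : Prop :=
  ∀ N : ℕ, SymFn.toVars N g = msymm (Fin N) K μ

/-- `f` is the monic Jack symmetric function `P_ν` with parameter `θ = 1/α`:
`f` is `m_ν` plus a linear combination of the `m_μ` with `μ ≺ ν`, and it is orthogonal to all
these `m_μ`. -/
structure IsJackP {K : Type*} [Field K] (θ : K) {n : ℕ} (ν : n.Partition) (f : SymFn K) :
    Prop where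
  triangular : ∃ u : n.Partition → K, u ν = 1 ∧ (∀ μ, u μ ≠ 0 → DomLE μ ν) ∧
    ∀ N : ℕ, SymFn.toVars N f = ∑ μ, u μ • msymm (Fin N) K μ
  orthogonal : ∀ μ : n.Partition, DomLE μ ν → μ ≠ ν →
    ∀ g : SymFn K, IsMonomialSymm μ g → hall θ f g = 0

/-- The monic Jack symmetric function `P_ν`, the one with `IsJackP θ ν`. -/
def jackP {K : Type*} [Field K] (θ : K) {n : ℕ} (ν : n.Partition) : SymFn K :=
  Classical.epsilon (IsJackP θ ν)

/-- The partition with the parts `lam 0, …, lam (N - 1)` (zeros are dropped). -/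
def toPartition {N : ℕ} (lam : Fin N → ℕ) : (∑ i, lam i).Partition :=
  Nat.Partition.ofSums _ (Finset.univ.val.map lam) rfl

/-- The factor `c_λ = ∏_{s ∈ λ} (α a(s) + l(s) + 1)` with `α = 1/θ`. The box `s` in row `i` and
column `j` (both counted from 0) has arm length `λ_i - j - 1`, and its leg length is the number of
rows below row `i` with more than `j` boxes. -/
def jackFactor {K : Type*} [Field K] (θ : K) {N : ℕ} (lam : Fin N → ℕ) : K :=
  ∏ i : Fin N, ∏ j ∈ Finset.range (lam i),
    (((lam i : K) - j - 1) / θ +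
      ((Finset.univ.filter fun k : Fin N => i < k ∧ j < lam k).card : K) + 1)

/-- The Jack polynomial `J_λ(x_1, …, x_N; θ) = c_λ P_λ(x_1, …, x_N)`. -/
def jackJ {K : Type*} [Field K] (θ : K) {N : ℕ} (lam : Fin N → ℕ) : MvPolynomial (Fin N) K :=
  jackFactor θ lam • SymFn.toVars N (jackP θ (toPartition lam))

/-! ### Eigenvalues -/

/-- `h^{(r)}_m(x_1, …, x_N)`: the sum of the complete homogeneous symmetric polynomials `h_m` in
`(x_i)_{i ∈ s}` over all `r`-element subsets `s`; it is zero for `m < 0`. -/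
def hSub {K : Type*} [Field K] {N : ℕ} (r : ℕ) (m : ℤ) (x : Fin N → K) : K :=
  if m < 0 then 0
  else ∑ s ∈ Finset.powersetCard r (Finset.univ : Finset (Fin N)),
    aeval (fun i : s => x i) (hsymm s K m.toNat)

/-- `ℓ_i = λ_i + θ (N - i)` for `1 ≤ i ≤ N`; here `i` is counted from 0. -/
def ell {K : Type*} [Field K] (θ : K) {N : ℕ} (lam : Fin N → ℕ) (i : Fin N) : K :=
  (lam i : K) + θ * ((N : K) - ((i : ℕ) + 1))

/-- `eig_m(λ) = ∑_{r=1}^N (-θ)^{r-1} h^{(r)}_{m+1-r}(ℓ_1, …, ℓ_N)`. -/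
def eig {K : Type*} [Field K] (θ : K) {N : ℕ} (lam : Fin N → ℕ) (m : ℕ) : K :=
  ∑ r ∈ Finset.Icc 1 N, (-θ) ^ (r - 1) * hSub r ((m : ℤ) + 1 - r) (ell θ lam)

/-- The upper triangular matrix with diagonal entries `ℓ_i` and all entries `-θ` above it. -/
def eigMatrix {K : Type*} [Field K] (θ : K) {N : ℕ} (lam : Fin N → ℕ) :
    Matrix (Fin N) (Fin N) K :=
  Matrix.of fun i j => if i = j then ell θ lam i else if i < j then -θ else 0

end HeckmanPolychronakos

end

/-!
On symmetric polynomials in `N` variables, `𝒫_{m+1}` comes from an operator `T` on `Λ` that is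
obtained from a matrix of operators in multiplication by `p_k` and `∂/∂p_k`. For the form `⟨·, ·⟩`
the adjoint of multiplication by `p_k` is `θ⁻¹ k ∂/∂p_k`, so transposing the matrix amounts to
taking adjoints of its entries, and `T` is self-adjoint. It is triangular for the dominance order,
so with `W = span {m_μ : μ ≺ λ}` and `u` its diagonal entry at `λ`, both `T W ⊆ W` and
`T P_λ - u P_λ ∈ W` hold. Self-adjointness puts this difference also in the orthogonal complement
of `W`, which meets `W` only in `0`: the Gram determinant of the `m_μ`, `μ ≺ λ`, is the image of
one over an ordered field, where the form is positive definite because the parameter is positive.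

The eigenvalue is read off from the coefficients at the permutations of the exponent `λ`: on these,
`x_i 𝒟_i` acts, up to dominated terms, through the matrix `U`.
-/

noncomputable section

namespace HeckmanPolychronakos

open MvPolynomial

/-! ### Bilinear forms -/

section BilinearForm

open LinearMap (IsAdjointPair BilinForm)

section CommRing

variable {R V : Type*} [CommRing R] [AddCommGroup V] [Module R V] {B : BilinForm R V}

theorem isAdjointPair_swap (hB : B.IsSymm) {S T : Module.End R V} (h : IsAdjointPair B B S T) :
    IsAdjointPair B B T S := fun x y => by
  rw [hB.eq, ← h, hB.eq]

theorem isAdjointPair_sum {ι : Type*} (s : Finset ι) {S T : ι → Module.End R V}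
    (h : ∀ i ∈ s, IsAdjointPair B B (S i) (T i)) :
    IsAdjointPair B B (∑ i ∈ s, S i : Module.End R V) (∑ i ∈ s, T i : Module.End R V) :=
  fun x y => by
    simp only [LinearMap.sum_apply, map_sum]
    exact Finset.sum_congr rfl fun i hi => h i hi x y

theorem isAdjointPair_matrix_pow {n : Type*} [Fintype n] [DecidableEq n]
    {A : Matrix n n (Module.End R V)} (h : ∀ k l, IsAdjointPair B B (A k l) (A l k)) (m : ℕ)
    (k l : n) : IsAdjointPair B B ((A ^ m) k l) ((A ^ m) l k) := by
  induction m generalizing k l with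
  | zero =>
    rw [pow_zero, Matrix.one_apply, Matrix.one_apply]
    by_cases hkl : k = l
    · simpa only [hkl, if_true] using LinearMap.isAdjointPair_one
    · rw [if_neg hkl, if_neg (Ne.symm hkl)]
      exact LinearMap.isAdjointPair_zero
  | succ m ih =>
    rw [pow_succ, Matrix.mul_apply, ← pow_succ, pow_succ', Matrix.mul_apply]
    exact isAdjointPair_sum _ fun j _ => (ih k j).mul (h j l)

theorem apply_eq_smul_of_mem_orthogonal {T : Module.End R V} (hT : B.IsSelfAdjoint T)
    {W : Submodule R V} (hW : Disjoint W (B.orthogonal W)) (hTW : ∀ w ∈ W, T w ∈ W)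
    {f v : V} {u : R} (hv : T v - u • v ∈ W) (hfv : f - v ∈ W) (hf : f ∈ B.orthogonal W) :
    T f = u • f := by
  have mem : T f - u • f ∈ W := by
    have h : T f - u • f = T (f - v) - u • (f - v) + (T v - u • v) := by
      rw [map_sub, smul_sub]
      abel
    rw [h]
    exact W.add_mem (W.sub_mem (hTW _ hfv) (W.smul_mem u hfv)) hv
  have mem_orthogonal : T f - u • f ∈ B.orthogonal W := by
    refine Submodule.sub_mem _ (fun w hw => ?_) (Submodule.smul_mem _ u hf)
    exact (hT w f).symm.trans (hf _ (hTW w hw))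
  exact sub_eq_zero.1 (Submodule.disjoint_def.1 hW _ mem mem_orthogonal)

/-- The Gram matrix of the family `v` with respect to `B`. -/
def gram {ι : Type*} (B : BilinForm R V) (v : ι → V) : Matrix ι ι R :=
  Matrix.of fun i j => B (v i) (v j)

theorem gram_mulVec {ι : Type*} [Fintype ι] (v : ι → V) (c : ι → R) (i : ι) :
    (gram B v).mulVec c i = B (v i) (∑ j, c j • v j) := by
  simp [gram, Matrix.mulVec, dotProduct, mul_comm]

theorem disjoint_span_orthogonal_of_det_gram_ne_zero {ι : Type*} [Fintype ι] [DecidableEq ι]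
    [IsDomain R] {v : ι → V} (h : (gram B v).det ≠ 0) :
    Disjoint (Submodule.span R (Set.range v)) (B.orthogonal (Submodule.span R (Set.range v))) := by
  refine Submodule.disjoint_def.2 fun x hx hx' => ?_
  obtain ⟨c, rfl⟩ := (Submodule.mem_span_range_iff_exists_fun R).1 hx
  suffices c = 0 by simp [this]
  refine Matrix.eq_zero_of_mulVec_eq_zero h (funext fun i => ?_)
  rw [gram_mulVec]
  exact hx' (v i) (Submodule.subset_span ⟨i, rfl⟩)

theorem det_gram_ne_zero_of_anisotropic {ι : Type*} [Fintype ι] [DecidableEq ι]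
    [IsDomain R] {v : ι → V} (hv : LinearIndependent R v) (hB : ∀ x, x ≠ 0 → B x x ≠ 0) :
    (gram B v).det ≠ 0 := by
  intro h
  obtain ⟨c, hc, hc'⟩ := Matrix.exists_mulVec_eq_zero_iff.2 h
  refine hB (∑ i, c i • v i) (fun h => hc (funext (Fintype.linearIndependent_iff.1 hv c h))) ?_
  have expand (y : V) : B (∑ i, c i • v i) y = ∑ i, c i * B (v i) y := by simp
  rw [expand]
  exact Finset.sum_eq_zero fun i _ => by rw [← gram_mulVec, hc', Pi.zero_apply, mul_zero]

end CommRing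

section Field

variable {K V : Type*} [Field K] [AddCommGroup V] [Module K V] {B : BilinForm K V}

theorem isCompl_orthogonal_of_disjoint {W : Submodule K V} [FiniteDimensional K W]
    (hW : Disjoint W (B.orthogonal W)) : IsCompl W (B.orthogonal W) := by
  refine ⟨hW, Submodule.codisjoint_iff_exists_add_eq.2 fun x => ?_⟩
  let restrictDual : V →ₗ[K] Module.Dual K W := W.dualRestrict ∘ₗ B.flip
  have injective : Function.Injective (restrictDual ∘ₗ W.subtype) := by
    rw [← LinearMap.ker_eq_bot, LinearMap.ker_eq_bot']
    intro w hw
    exact Subtype.ext (Submodule.disjoint_def.1 hW w w.2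
      fun y hy => LinearMap.congr_fun hw ⟨y, hy⟩)
  obtain ⟨w, hw⟩ := (LinearMap.injective_iff_surjective_of_finrank_eq_finrank
    Subspace.dual_finrank_eq.symm).1 injective (restrictDual x)
  refine ⟨w, x - w, w.2, fun y hy => ?_, add_sub_cancel _ _⟩
  have hy : B y w = B y x := LinearMap.congr_fun hw ⟨y, hy⟩
  rw [map_sub, hy, sub_self]

theorem existsUnique_sub_mem_and_mem_orthogonal {W : Submodule K V} [FiniteDimensional K W]
    (hW : Disjoint W (B.orthogonal W)) (x : V) : ∃! f, f - x ∈ W ∧ f ∈ B.orthogonal W := by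
  obtain ⟨w, f, hw, hf, rfl⟩ :=
    Submodule.codisjoint_iff_exists_add_eq.1 (isCompl_orthogonal_of_disjoint hW).codisjoint x
  refine ⟨f, ⟨by simpa using W.neg_mem hw, hf⟩, fun f' hf' => ?_⟩
  refine sub_eq_zero.1 (Submodule.disjoint_def.1 hW _ ?_ (Submodule.sub_mem _ hf'.2 hf))
  have h : f' - f = f' - (w + f) + w := by abel
  exact h ▸ W.add_mem hf'.1 hw

end Field

end BilinearForm

/-! ### The deformed Hall form -/

section Hall

variable {K : Type*} [Field K]

/-- The norm `⟨p_a, p_a⟩` of the product `p_a = ∏_k p_k ^ {a_k}` of power sums. -/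
def hallWeight (θ : K) (a : ℕ+ →₀ ℕ) : K :=
  a.prod fun (k : ℕ+) (r : ℕ) => (((k : ℕ) : K) / θ) ^ r * (r.factorial : K)

theorem hall_eq_sum_of_subset (θ : K) (f g : SymFn K) {s : Finset (ℕ+ →₀ ℕ)}
    (hs : f.support ⊆ s) :
    hall θ f g = ∑ a ∈ s, f.coeff a * g.coeff a * hallWeight θ a := by
  refine Finset.sum_subset hs fun a _ ha => ?_
  rw [notMem_support_iff.1 ha, zero_mul, zero_mul]

theorem hall_comm (θ : K) (f g : SymFn K) : hall θ f g = hall θ g f := by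
  classical
  rw [hall_eq_sum_of_subset θ f g Finset.subset_union_left,
    hall_eq_sum_of_subset θ g f (Finset.subset_union_right (s₁ := f.support))]
  exact Finset.sum_congr rfl fun a _ => by ring

theorem hall_add_right (θ : K) (f g g' : SymFn K) :
    hall θ f (g + g') = hall θ f g + hall θ f g' := by
  simp only [hall, coeff_add, mul_add, add_mul, Finset.sum_add_distrib]

theorem hall_smul_right (θ c : K) (f g : SymFn K) : hall θ f (c • g) = c * hall θ f g := by
  simp only [hall, coeff_smul, Finset.mul_sum, smul_eq_mul]
  exact Finset.sum_congr rfl fun a _ => by ring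

/-- The deformed Hall inner product `hall θ` as a bilinear form. -/
def hallForm (θ : K) : LinearMap.BilinForm K (SymFn K) :=
  LinearMap.mk₂ K (hall θ)
    (fun f f' g => by simp only [hall_comm θ _ g, hall_add_right])
    (fun c f g => by simp only [hall_comm θ _ g, hall_smul_right, smul_eq_mul])
    (hall_add_right θ) (fun c => hall_smul_right θ c)

theorem hallForm_apply (θ : K) (f g : SymFn K) : hallForm θ f g = hall θ f g := rfl

theorem hallForm_isSymm (θ : K) : (hallForm θ).IsSymm := ⟨fun f g => hall_comm θ f g⟩

theorem hallForm_monomial_left (θ : K) (a : ℕ+ →₀ ℕ) (c : K) (g : SymFn K) :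
    hallForm θ (monomial a c) g = c * g.coeff a * hallWeight θ a := by
  classical
  rw [hallForm_apply, hall_eq_sum_of_subset θ _ g support_monomial_subset, Finset.sum_singleton,
    coeff_monomial, if_pos rfl]

theorem hallWeight_add_single (θ : K) (a : ℕ+ →₀ ℕ) (k : ℕ+) :
    hallWeight θ (a + Finsupp.single k 1) =
      hallWeight θ a * (((k : ℕ) : K) / θ * ((a k : K) + 1)) := by
  have split (b : ℕ+ →₀ ℕ) : hallWeight θ b =
      (((k : ℕ) : K) / θ) ^ b k * ((b k).factorial : K) * hallWeight θ (b.erase k) :=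
    (Finsupp.mul_prod_erase' b k _ (by simp)).symm
  have erase_eq : (a + Finsupp.single k 1).erase k = a.erase k := by
    rw [Finsupp.erase_add, Finsupp.erase_single, add_zero]
  rw [split, split a, erase_eq, Finsupp.add_apply, Finsupp.single_eq_same, Nat.factorial_succ,
    pow_succ]
  push_cast
  ring

theorem hallForm_X_mul (θ : K) (k : ℕ+) (f g : SymFn K) :
    hallForm θ (X k * f) g = hallForm θ f ((((k : ℕ) : K) / θ) • pderiv k g) := by
  induction f using MvPolynomial.induction_on' with
  | add f₁ f₂ h₁ h₂ => rw [mul_add, map_add, map_add, LinearMap.add_apply, h₁, h₂,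
      LinearMap.add_apply]
  | monomial a c =>
    have hX : (X k * monomial a c : SymFn K) = monomial (a + Finsupp.single k 1) c := by
      rw [mul_comm, X, monomial_mul, mul_one]
    rw [hX, hallForm_monomial_left, hallForm_monomial_left, hallWeight_add_single, coeff_smul,
      coeff_pderiv, smul_eq_mul]
    ring

section BaseChange

variable {F : Type*} [Field F]

theorem map_hallWeight (φ : F →+* K) (t : F) (a : ℕ+ →₀ ℕ) :
    φ (hallWeight t a) = hallWeight (φ t) a := by
  simp only [hallWeight, map_finsuppProd, map_mul, map_pow, map_div₀, map_natCast]

theorem map_hall (φ : F →+* K) (t : F) (f g : SymFn F) :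
    φ (hall t f g) = hall (φ t) (map φ f) (map φ g) := by
  rw [hall_eq_sum_of_subset (φ t) _ _ (support_map_subset φ f), hall, map_sum]
  refine Finset.sum_congr rfl fun a _ => ?_
  rw [map_mul, map_mul, coeff_map, coeff_map]
  exact congrArg _ (map_hallWeight φ t a)

end BaseChange

section Positivity

variable {F : Type*} [Field F] [LinearOrder F] [IsStrictOrderedRing F] {t : F}

theorem hallWeight_pos (ht : 0 < t) (a : ℕ+ →₀ ℕ) : 0 < hallWeight t a :=
  Finset.prod_pos fun k _ => by
    have := k.pos
    positivity

theorem hall_self_pos (ht : 0 < t) {f : SymFn F} (hf : f ≠ 0) : 0 < hall t f f := by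
  refine Finset.sum_pos (fun a ha => ?_) (support_nonempty.2 hf)
  exact mul_pos (mul_self_pos.2 (mem_support_iff.1 ha)) (hallWeight_pos ht a)

end Positivity

end Hall

/-! ### The Lax matrix -/

section Lax

open LinearMap (IsAdjointPair)

variable {K : Type*} [Field K]

/-- Multiplication by the power sum `p_{k+1}`. The shift of the index makes it range over `ℕ`. -/
def pMul (k : ℕ) : Module.End K (SymFn K) := LinearMap.mulLeft K (X k.succPNat)

/-- The operator `(k + 1) ∂ / ∂p_{k+1}`, which is adjoint to `θ p_{k+1}`. -/
def pDer (k : ℕ) : Module.End K (SymFn K) := ((k : K) + 1) • (pderiv k.succPNat).toLinearMap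

theorem pMul_apply (k : ℕ) (f : SymFn K) : pMul k f = X k.succPNat * f := rfl

theorem pDer_apply (k : ℕ) (f : SymFn K) : pDer k f = ((k : K) + 1) • pderiv k.succPNat f := rfl

/-- The entries of the Lax matrix, with rows and columns counted from 0. The parameter `c` is the
value given to the power sum `p_0`. -/
def laxEntry (θ c : K) (k l : ℕ) : Module.End K (SymFn K) :=
  if l < k then pDer (k - l - 1)
  else if k < l then θ • pMul (l - k - 1)
  else ((1 - θ) * ((k : K) + 1) + θ * c) • 1

theorem laxEntry_below (θ c : K) (l j : ℕ) : laxEntry θ c (l + j + 1) l = pDer j := by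
  rw [laxEntry, if_pos (by omega), show l + j + 1 - l - 1 = j by omega]

theorem laxEntry_above (θ c : K) (k j : ℕ) : laxEntry θ c k (k + j + 1) = θ • pMul j := by
  rw [laxEntry, if_neg (by omega), if_pos (by omega), show k + j + 1 - k - 1 = j by omega]

theorem laxEntry_self (θ c : K) (k : ℕ) :
    laxEntry θ c k k = ((1 - θ) * ((k : K) + 1) + θ * c) • 1 := by
  rw [laxEntry, if_neg (lt_irrefl k), if_neg (lt_irrefl k)]

/-- The Lax matrix: the matrix of operators on symmetric functions through which `x_i D_i` acts on
the sums `∑_{k < n} f_k x_i ^ {k+1}` with symmetric `f_k`. -/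
def lax (θ c : K) (n : ℕ) : Matrix (Fin n) (Fin n) (Module.End K (SymFn K)) :=
  Matrix.of fun k l => laxEntry θ c k l

/-- The action of the Heckman–Polychronakos operator `P_{m+1}` on symmetric functions of
degree `n`, with `p_0 = c`. -/
def hpSym (θ c : K) (n m : ℕ) : Module.End K (SymFn K) :=
  ∑ k : Fin n, ∑ l : Fin n, pMul k * (lax θ c n ^ m) k l * pDer l

variable {θ : K}

theorem isAdjointPair_pMul_pDer (hθ : θ ≠ 0) (k : ℕ) :
    IsAdjointPair (hallForm θ) (hallForm θ) (θ • pMul k : Module.End K (SymFn K)) (pDer k) :=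
  fun f g => by
    rw [LinearMap.smul_apply, pMul_apply, map_smul, LinearMap.smul_apply, hallForm_X_mul,
      ← map_smul, pDer_apply, smul_smul, mul_div_cancel₀ _ hθ]
    simp

theorem isAdjointPair_pDer_pMul (hθ : θ ≠ 0) (k : ℕ) :
    IsAdjointPair (hallForm θ) (hallForm θ) (pDer k) (θ • pMul k : Module.End K (SymFn K)) :=
  isAdjointPair_swap (hallForm_isSymm θ) (isAdjointPair_pMul_pDer hθ k)

theorem isAdjointPair_laxEntry (hθ : θ ≠ 0) (c : K) (k l : ℕ) :
    IsAdjointPair (hallForm θ) (hallForm θ) (laxEntry θ c k l) (laxEntry θ c l k) := by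
  rcases lt_trichotomy k l with h | rfl | h
  · obtain ⟨j, rfl⟩ := Nat.exists_eq_add_of_lt h
    rw [laxEntry_above, laxEntry_below]
    exact isAdjointPair_pMul_pDer hθ j
  · rw [laxEntry_self]
    exact LinearMap.isAdjointPair_one.smul _
  · obtain ⟨j, rfl⟩ := Nat.exists_eq_add_of_lt h
    rw [laxEntry_above, laxEntry_below]
    exact isAdjointPair_pDer_pMul hθ j

theorem isAdjointPair_lax (hθ : θ ≠ 0) (c : K) {n : ℕ} (k l : Fin n) :
    IsAdjointPair (hallForm θ) (hallForm θ) (lax θ c n k l) (lax θ c n l k) :=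
  isAdjointPair_laxEntry hθ c k l

theorem isSelfAdjoint_hpSym (hθ : θ ≠ 0) (c : K) (n m : ℕ) :
    (hallForm θ).IsSelfAdjoint (hpSym θ c n m) := by
  have left : θ • hpSym θ c n m =
      ∑ k : Fin n, ∑ l : Fin n, (θ • pMul k) * (lax θ c n ^ m) k l * pDer l := by
    simp only [hpSym, Finset.smul_sum, smul_mul_assoc]
  have right : θ • hpSym θ c n m =
      ∑ k : Fin n, ∑ l : Fin n, (θ • pMul l) * ((lax θ c n ^ m) l k * pDer k) := by
    rw [Finset.sum_comm]
    simp only [left, mul_assoc]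
  have smul_hpSym : IsAdjointPair (hallForm θ) (hallForm θ)
      (θ • hpSym θ c n m : Module.End K (SymFn K))
      (θ • hpSym θ c n m : Module.End K (SymFn K)) := by
    nth_rewrite 2 [right]
    rw [left]
    refine isAdjointPair_sum _ fun k _ => isAdjointPair_sum _ fun l _ => ?_
    exact ((isAdjointPair_pMul_pDer hθ k).mul
      (isAdjointPair_matrix_pow (isAdjointPair_lax hθ c) m k l)).mul (isAdjointPair_pDer_pMul hθ l)
  have h := smul_hpSym.smul θ⁻¹
  rwa [← LinearMap.coe_smul, inv_smul_smul₀ hθ] at h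

end Lax

section Homog

variable {K : Type*} [Field K]

/-- `f` is a homogeneous symmetric function of degree `n`, where `p_k` has degree `k`. -/
abbrev IsHomog (f : SymFn K) (n : ℕ) : Prop :=
  IsWeightedHomogeneous (fun k : ℕ+ => (k : ℕ)) f n

theorem IsHomog.smul {f : SymFn K} {n : ℕ} (hf : IsHomog f n) (c : K) : IsHomog (c • f) n :=
  (weightedHomogeneousSubmodule K (fun k : ℕ+ => (k : ℕ)) n).smul_mem c hf

theorem IsHomog.le_of_mem_vars {f : SymFn K} {n : ℕ} (hf : IsHomog f n) {k : ℕ+}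
    (hk : k ∈ f.vars) : (k : ℕ) ≤ n := by
  obtain ⟨d, hd, hkd⟩ := (mem_vars_iff_mem_support k).1 hk
  rw [← hf (mem_support_iff.1 hd)]
  exact Finsupp.le_weight_of_ne_zero' _ (Finsupp.mem_support_iff.1 hkd)

theorem IsHomog.pDer {f : SymFn K} {n k m : ℕ} (hf : IsHomog f n) (h : m + (k + 1) = n) :
    IsHomog (pDer k f) m :=
  IsHomog.smul (IsWeightedHomogeneous.pderiv hf (by simpa using h)) _

theorem IsHomog.pMul {f : SymFn K} {n k m : ℕ} (hf : IsHomog f n) (h : n + (k + 1) = m) :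
    IsHomog (pMul k f) m := by
  rw [pMul_apply, ← h, add_comm]
  exact (isWeightedHomogeneous_X K _ _).mul hf

variable {θ c : K} {v : SymFn K}

theorem isHomog_laxEntry {n k l : ℕ} (hk : k < n) (hl : l < n) (hv : IsHomog v (n - (l + 1))) :
    IsHomog (laxEntry θ c k l v) (n - (k + 1)) := by
  rcases lt_trichotomy k l with h | rfl | h
  · obtain ⟨j, rfl⟩ := Nat.exists_eq_add_of_lt h
    rw [laxEntry_above]
    exact (hv.pMul (by omega)).smul θ
  · rw [laxEntry_self]
    exact hv.smul _
  · obtain ⟨j, rfl⟩ := Nat.exists_eq_add_of_lt h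
    rw [laxEntry_below]
    exact hv.pDer (by omega)

theorem isHomog_lax_pow {n : ℕ} (m : ℕ) (k l : Fin n) (hv : IsHomog v (n - (l + 1))) :
    IsHomog ((lax θ c n ^ m) k l v) (n - (k + 1)) := by
  induction m generalizing k with
  | zero =>
    rw [pow_zero, Matrix.one_apply]
    split_ifs with h
    · exact h ▸ hv
    · exact isWeightedHomogeneous_zero _ _ _
  | succ m ih =>
    rw [pow_succ', Matrix.mul_apply, LinearMap.sum_apply]
    exact IsWeightedHomogeneous.sum _ _ _ fun j _ => isHomog_laxEntry k.2 j.2 (ih j)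

theorem isHomog_hpSym {n m : ℕ} (hv : IsHomog v n) : IsHomog (hpSym θ c n m v) n := by
  simp only [hpSym, LinearMap.sum_apply]
  refine IsWeightedHomogeneous.sum _ _ _ fun k _ => IsWeightedHomogeneous.sum _ _ _ fun l _ => ?_
  exact (isHomog_lax_pow m k l (hv.pDer (by omega))).pMul (by omega)

end Homog

/-! ### Dunkl operators on symmetric functions -/

theorem derivation_aeval {R σ A M : Type*} [CommSemiring R] [CommSemiring A] [Algebra R A]
    [AddCommMonoid M] [Module R M] [Module A M] (D : Derivation R A M)
    (g : σ → A) (s : Finset σ) {f : MvPolynomial σ R} (hf : f ∈ supported R (s : Set σ)) :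
    D (aeval g f) = ∑ l ∈ s, aeval g (pderiv l f) • D (g l) := by
  classical
  induction hf using Algebra.adjoin_induction with
  | mem x hx =>
    obtain ⟨k, hk, rfl⟩ := hx
    rw [aeval_X, Finset.sum_eq_single_of_mem k hk, pderiv_X_self, map_one, one_smul]
    intro l _ hl
    rw [pderiv_X_of_ne (Ne.symm hl), map_zero, zero_smul]
  | algebraMap r => simp [algebraMap_eq]
  | add f g _ _ hf hg => simp only [map_add, hf, hg, add_smul, Finset.sum_add_distrib]
  | mul f g _ _ hf hg =>
    rw [map_mul, Derivation.leibniz, hf, hg, Finset.smul_sum, Finset.smul_sum,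
      ← Finset.sum_add_distrib]
    refine Finset.sum_congr rfl fun l _ => ?_
    rw [pderiv_mul, map_add, map_mul, map_mul, add_smul, smul_smul, smul_smul, mul_comm, add_comm]
    rw [mul_comm]

theorem pderiv_psum {R σ : Type*} [CommSemiring R] [Fintype σ] (i : σ) (k : ℕ) :
    pderiv i (psum σ R k) = (k : MvPolynomial σ R) * X i ^ (k - 1) := by
  rw [psum, map_sum, Finset.sum_eq_single_of_mem i (Finset.mem_univ _)]
  · rw [pderiv_pow, pderiv_X_self, mul_one]
  · intro j _ hj
    rw [pderiv_pow, pderiv_X_of_ne hj, mul_zero]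

section Intertwining

variable {K : Type*} [Field K] {N : ℕ}

theorem toVars_X (k : ℕ+) : SymFn.toVars N (X k : SymFn K) = psum (Fin N) K k :=
  aeval_X _ _

theorem toVars_isSymmetric (f : SymFn K) : (SymFn.toVars N f).IsSymmetric := by
  intro e
  have h : (rename e : MvPolynomial (Fin N) K →ₐ[K] _).comp (SymFn.toVars N) = SymFn.toVars N :=
    algHom_ext fun k => by rw [AlgHom.comp_apply, toVars_X, rename_psum]
  exact congrArg (fun φ => φ f) h

theorem X_mul_pderiv_toVars (i : Fin N) {f : SymFn K} {n : ℕ} (hf : IsHomog f n) :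
    X i * pderiv i (SymFn.toVars N f) =
      ∑ l ∈ Finset.range n, X i ^ (l + 1) * SymFn.toVars N (pDer l f) := by
  have hs : f ∈ supported K
      (((Finset.range n).map ⟨Nat.succPNat, Nat.succPNat_injective⟩ : Finset ℕ+) : Set ℕ+) := by
    refine mem_supported.2 fun k hk => Finset.mem_coe.2 (Finset.mem_map.2 ⟨k.natPred, ?_, ?_⟩)
    · have := hf.le_of_mem_vars hk
      have := k.natPred_add_one
      exact Finset.mem_range.2 (by omega)
    · exact k.succPNat_natPred
  rw [SymFn.toVars, derivation_aeval _ _ _ hs, Finset.sum_map, Finset.mul_sum]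
  refine Finset.sum_congr rfl fun l _ => ?_
  simp only [Function.Embedding.coeFn_mk, Nat.succPNat_coe, Nat.succ_eq_add_one, pDer_apply,
    map_smul, pderiv_psum, add_tsub_cancel_right]
  simp only [smul_eq_C_mul, smul_eq_mul, map_add, map_one, map_natCast]
  push_cast
  ring

/-- The operator `x_i D_i`. -/
def xDunkl (θ : K) (i : Fin N) : Module.End K (MvPolynomial (Fin N) K) :=
  LinearMap.mulLeft K (X i) * dunkl θ i

theorem xDunkl_apply (θ : K) (i : Fin N) (f : MvPolynomial (Fin N) K) :
    xDunkl θ i f = X i * pderiv i f +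
      θ • ∑ j : {j : Fin N // j ≠ i}, X i * diffQuot K j.2 f := by
  simp only [xDunkl, dunkl, Module.End.mul_apply, LinearMap.mulLeft_apply, LinearMap.add_apply,
    LinearMap.smul_apply, LinearMap.sum_apply, mul_add, mul_smul_comm, Finset.mul_sum]
  rfl

theorem diffQuot_X_pow_mul {i j : Fin N} (h : j ≠ i) (k : ℕ) {F : MvPolynomial (Fin N) K}
    (hF : rename (Equiv.swap i j) F = F) :
    diffQuot K h (X i ^ k * F) = (∑ a ∈ Finset.range k, X i ^ a * X j ^ (k - 1 - a)) * F := by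
  apply mul_left_cancel₀ (X_sub_X_ne_zero (K := K) h)
  rw [mul_diffQuot, map_mul, map_pow, rename_X, Equiv.swap_apply_left, hF, ← mul_assoc,
    mul_comm (X i - X j), (Commute.all _ _).geom_sum₂_mul, sub_mul]

theorem sum_ne_X_pow (i : Fin N) (k : ℕ) :
    ∑ j : {j : Fin N // j ≠ i}, (X j.1 : MvPolynomial (Fin N) K) ^ k =
      psum (Fin N) K k - X i ^ k := by
  rw [psum, ← Finset.sum_erase_eq_sub (Finset.mem_univ i)]
  exact (Finset.sum_subtype (Finset.univ.erase i) (p := fun j => j ≠ i) (fun j => by simp)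
    fun j => (X j : MvPolynomial (Fin N) K) ^ k).symm

theorem xDunkl_of_isSymmetric (θ : K) (i : Fin N) {F : MvPolynomial (Fin N) K}
    (hF : F.IsSymmetric) : xDunkl θ i F = X i * pderiv i F := by
  have h (j : {j : Fin N // j ≠ i}) : diffQuot K j.2 F = 0 := by
    simpa using diffQuot_X_pow_mul j.2 0 (hF _)
  rw [xDunkl_apply]
  simp [h]

theorem sum_X_mul_diffQuot_X_pow_mul (i : Fin N) (k : ℕ) {F : MvPolynomial (Fin N) K}
    (hF : F.IsSymmetric) :
    ∑ j : {j : Fin N // j ≠ i}, X i * diffQuot K j.2 (X i ^ (k + 1) * F) =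
      (∑ a ∈ Finset.range k, X i ^ (a + 1) * psum (Fin N) K (k - a) +
        ((N : MvPolynomial (Fin N) K) - ((k : MvPolynomial (Fin N) K) + 1)) *
          X i ^ (k + 1)) * F := by
  have inner (a : ℕ) (ha : a ∈ Finset.range (k + 1)) : ∑ j : {j : Fin N // j ≠ i},
      (X i * (X i ^ a * X j.1 ^ (k - a)) : MvPolynomial (Fin N) K) =
        X i ^ (a + 1) * psum (Fin N) K (k - a) - X i ^ (k + 1) := by
    have exponent : a + 1 + (k - a) = k + 1 := by
      have := Finset.mem_range.1 ha
      omega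
    simp only [← mul_assoc, ← pow_succ']
    rw [← Finset.mul_sum, sum_ne_X_pow, mul_sub, ← pow_add, exponent]
  simp only [diffQuot_X_pow_mul _ _ (hF _), ← mul_assoc, Finset.mul_sum, add_tsub_cancel_right]
  rw [← Finset.sum_mul, Finset.sum_comm]
  congr 1
  simp only [← mul_assoc] at inner
  rw [Finset.sum_congr rfl inner, Finset.sum_sub_distrib, Finset.sum_range_succ, Finset.sum_const,
    Finset.card_range, tsub_self, psum_zero, Fintype.card_fin, nsmul_eq_mul]
  push_cast
  ring

theorem xDunkl_X_pow_mul (θ : K) (i : Fin N) (k : ℕ) {F : MvPolynomial (Fin N) K}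
    (hF : F.IsSymmetric) :
    xDunkl θ i (X i ^ (k + 1) * F) =
      ∑ a ∈ Finset.range k, X i ^ (a + 1) * (θ • (psum (Fin N) K (k - a) * F)) +
      ((1 - θ) * ((k : K) + 1) + θ * N) • (X i ^ (k + 1) * F) +
      X i ^ (k + 1) * (X i * pderiv i F) := by
  rw [xDunkl_apply, sum_X_mul_diffQuot_X_pow_mul i k hF, pderiv_mul, pderiv_pow, pderiv_X_self]
  simp only [mul_smul_comm, ← Finset.smul_sum, ← mul_assoc, ← Finset.sum_mul]
  simp only [smul_eq_C_mul, map_add, map_sub, map_mul, map_natCast, map_one,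
    add_tsub_cancel_right, pow_succ]
  push_cast
  ring

theorem xDunkl_add_smul_X_pow_mul (θ c : K) (i : Fin N) (l d : ℕ) {v : SymFn K}
    (hv : IsHomog v d) :
    (xDunkl θ i + (θ * (c - N)) • 1) (X i ^ (l + 1) * SymFn.toVars N v) =
      ∑ k ∈ Finset.range (l + 1 + d), X i ^ (k + 1) * SymFn.toVars N (laxEntry θ c k l v) := by
  have above : ∑ k ∈ Finset.range l, X i ^ (k + 1) * SymFn.toVars N (laxEntry θ c k l v) =
      ∑ k ∈ Finset.range l, X i ^ (k + 1) *
        (θ • (psum (Fin N) K (l - k) * SymFn.toVars N v)) := by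
    refine Finset.sum_congr rfl fun k hk => ?_
    obtain ⟨j, rfl⟩ := Nat.exists_eq_add_of_lt (Finset.mem_range.1 hk)
    rw [laxEntry_above, LinearMap.smul_apply, map_smul, pMul_apply, map_mul, toVars_X,
      Nat.succPNat_coe, add_assoc, add_tsub_cancel_left]
  have below : ∑ j ∈ Finset.range d,
      X i ^ (l + 1 + j + 1) * SymFn.toVars N (laxEntry θ c (l + 1 + j) l v) =
        X i ^ (l + 1) * (X i * pderiv i (SymFn.toVars N v)) := by
    rw [X_mul_pderiv_toVars i hv, Finset.mul_sum]
    refine Finset.sum_congr rfl fun j _ => ?_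
    rw [add_right_comm l, laxEntry_below, ← mul_assoc, ← pow_add]
    congr 2
    ring
  rw [Finset.sum_range_add, Finset.sum_range_succ, above, below, laxEntry_self,
    LinearMap.add_apply, xDunkl_X_pow_mul θ i l (toVars_isSymmetric v)]
  simp only [LinearMap.smul_apply, Module.End.one_apply, map_smul]
  simp only [smul_eq_C_mul, map_add, map_mul, map_sub, map_natCast, map_one]
  ring

theorem xDunkl_add_smul_sum (θ c : K) (i : Fin N) {n : ℕ} {v : Fin n → SymFn K}
    (hv : ∀ l, IsHomog (v l) (n - (l + 1))) :
    (xDunkl θ i + (θ * (c - N)) • 1) (∑ l : Fin n, X i ^ ((l : ℕ) + 1) * SymFn.toVars N (v l)) =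
      ∑ k : Fin n, X i ^ ((k : ℕ) + 1) * SymFn.toVars N (∑ l, lax θ c n k l (v l)) := by
  simp only [map_sum, Finset.mul_sum]
  rw [Finset.sum_comm]
  refine Finset.sum_congr rfl fun l _ => ?_
  have hl : (l : ℕ) + 1 + (n - (l + 1)) = n := Nat.add_sub_of_le l.2
  rw [xDunkl_add_smul_X_pow_mul θ c i l _ (hv l), hl, Finset.sum_range]
  rfl

theorem xDunkl_add_smul_pow (θ c : K) (i : Fin N) {n : ℕ} (m : ℕ) {f : SymFn K}
    (hf : IsHomog f n) :
    ((xDunkl θ i + (θ * (c - N)) • 1) ^ m) (xDunkl θ i (SymFn.toVars N f)) =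
      ∑ k : Fin n, X i ^ ((k : ℕ) + 1) *
        SymFn.toVars N (∑ l : Fin n, (lax θ c n ^ m) k l (pDer l f)) := by
  induction m with
  | zero =>
    rw [pow_zero, pow_zero, Module.End.one_apply, xDunkl_of_isSymmetric θ i (toVars_isSymmetric f),
      X_mul_pderiv_toVars i hf, Finset.sum_range]
    refine Finset.sum_congr rfl fun k _ => ?_
    rw [Finset.sum_eq_single_of_mem k (Finset.mem_univ _), Matrix.one_apply_eq,
      Module.End.one_apply]
    intro l _ hl
    rw [Matrix.one_apply_ne hl.symm, LinearMap.zero_apply]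
  | succ m ih =>
    have hv (k : Fin n) :
        IsHomog (∑ l : Fin n, (lax θ c n ^ m) k l (pDer l f)) (n - (k + 1)) :=
      IsWeightedHomogeneous.sum _ _ _ fun l _ => isHomog_lax_pow m k l (hf.pDer (by omega))
    rw [pow_succ', Module.End.mul_apply, ih, xDunkl_add_smul_sum θ c i hv]
    refine Finset.sum_congr rfl fun k _ => ?_
    simp only [pow_succ' (lax θ c n), Matrix.mul_apply, LinearMap.sum_apply,
      map_sum (lax θ c n k _), Module.End.mul_apply]
    rw [Finset.sum_comm]

theorem toVars_hpSym (θ c : K) (n m : ℕ) {f : SymFn K} (hf : IsHomog f n) :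
    SymFn.toVars N (hpSym θ c n m f) =
      ∑ i, ((xDunkl θ i + (θ * (c - N)) • 1) ^ m) (xDunkl θ i (SymFn.toVars N f)) := by
  simp only [xDunkl_add_smul_pow θ c _ m hf]
  rw [Finset.sum_comm, hpSym, LinearMap.sum_apply, map_sum]
  refine Finset.sum_congr rfl fun k _ => ?_
  rw [← Finset.sum_mul]
  simp only [LinearMap.sum_apply, map_sum, Module.End.mul_apply, pMul_apply, map_mul, toVars_X,
    psum, Nat.succPNat_coe, Nat.succ_eq_add_one, Finset.mul_sum]

theorem toVars_hpSym_self (θ : K) (n m : ℕ) {f : SymFn K} (hf : IsHomog f n) :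
    SymFn.toVars N (hpSym θ N n m f) = hpOp N θ (m + 1) (SymFn.toVars N f) := by
  rw [toVars_hpSym θ N n m hf, sub_self, mul_zero, zero_smul]
  simp only [add_zero, hpOp, LinearMap.sum_apply, pow_succ]
  rfl

end Intertwining

/-! ### The dominance order -/

section Dominance

theorem sum_le_sum_take {l : List ℕ} (hl : l.Pairwise (· ≥ ·)) (k : ℕ) {s : Multiset ℕ}
    (hs : s ≤ (l : Multiset ℕ)) (hk : s.card ≤ k) : s.sum ≤ (l.take k).sum := by
  induction l generalizing k s with
  | nil =>
    obtain rfl : s = 0 := Multiset.le_zero.1 hs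
    simp
  | cons x l ih =>
    rw [List.pairwise_cons] at hl
    rcases Multiset.empty_or_exists_mem s with rfl | ⟨y, hy⟩
    · simp
    obtain ⟨k, rfl⟩ : ∃ k', k = k' + 1 :=
      Nat.exists_eq_succ_of_ne_zero ((Multiset.card_pos_iff_exists_mem.2 ⟨y, hy⟩).trans_le hk).ne'
    rw [List.take_succ_cons, List.sum_cons]
    rw [← Multiset.cons_coe] at hs
    by_cases hx : x ∈ s
    · obtain ⟨s, rfl⟩ := Multiset.exists_cons_of_mem hx
      rw [Multiset.sum_cons]
      rw [Multiset.card_cons] at hk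
      exact Nat.add_le_add_left (ih hl.2 k ((Multiset.cons_le_cons_iff x).1 hs) (by omega)) x
    · have hs' := (Multiset.le_cons_of_notMem hx).1 hs
      obtain ⟨s, rfl⟩ := Multiset.exists_cons_of_mem hy
      rw [Multiset.sum_cons]
      rw [Multiset.card_cons] at hk
      exact Nat.add_le_add (hl.1 y (Multiset.mem_coe.1 (Multiset.mem_of_le hs' hy)))
        (ih hl.2 k ((Multiset.le_cons_self s y).trans hs') (by omega))

theorem exists_le_map_eq {α β : Type*} (f : α → β) (s : Multiset α) {t : Multiset β}
    (h : t ≤ s.map f) : ∃ u ≤ s, u.map f = t := by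
  induction s using Multiset.induction_on generalizing t with
  | empty => exact ⟨0, le_rfl, (Multiset.le_zero.1 h).symm⟩
  | cons x s ih =>
    rw [Multiset.map_cons] at h
    by_cases hx : f x ∈ t
    · obtain ⟨t, rfl⟩ := Multiset.exists_cons_of_mem hx
      obtain ⟨u, hu, rfl⟩ := ih ((Multiset.cons_le_cons_iff _).1 h)
      exact ⟨x ::ₘ u, (Multiset.cons_le_cons_iff _).2 hu, Multiset.map_cons _ _ _⟩
    · obtain ⟨u, hu, rfl⟩ := ih ((Multiset.le_cons_of_notMem hx).1 h)
      exact ⟨u, hu.trans (Multiset.le_cons_self _ _), rfl⟩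

variable {n : ℕ} {μ ν : n.Partition}

theorem sum_le_partialSum (μ : n.Partition) {k : ℕ} {s : Multiset ℕ} (hs : s ≤ μ.parts)
    (hk : s.card ≤ k) : s.sum ≤ partialSum μ k :=
  sum_le_sum_take (Multiset.pairwise_sort _ _) k (by rwa [Multiset.sort_eq]) hk

theorem exists_sum_eq_partialSum (μ : n.Partition) (k : ℕ) :
    ∃ s ≤ μ.parts, s.card ≤ k ∧ s.sum = partialSum μ k := by
  refine ⟨((μ.parts.sort (· ≥ ·)).take k : List ℕ), ?_, ?_, ?_⟩
  · conv_rhs => rw [← Multiset.sort_eq μ.parts (· ≥ ·)]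
    exact Multiset.coe_le.2 (List.take_sublist _ _).subperm
  · simp
  · simp [partialSum]

theorem partialSum_mono (μ : n.Partition) : Monotone (partialSum μ) := by
  intro k l h
  obtain ⟨s, hs, hc, he⟩ := exists_sum_eq_partialSum μ k
  exact he ▸ sum_le_partialSum μ hs (hc.trans h)

theorem DomLE.refl (μ : n.Partition) : DomLE μ μ := fun _ => le_rfl

theorem DomLE.trans {ρ : n.Partition} (h : DomLE μ ν) (h' : DomLE ν ρ) : DomLE μ ρ :=
  fun k => (h k).trans (h' k)

theorem DomLE.card_parts_le (h : DomLE μ ν) : ν.parts.card ≤ μ.parts.card := by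
  have hμ : partialSum μ μ.parts.card = n := by
    rw [partialSum, List.take_of_length_le (by simp), ← Multiset.sum_coe, Multiset.sort_eq,
      μ.parts_sum]
  have hν : partialSum ν μ.parts.card + ((ν.parts.sort (· ≥ ·)).drop μ.parts.card).sum = n := by
    rw [partialSum, List.sum_take_add_sum_drop, ← Multiset.sum_coe, Multiset.sort_eq, ν.parts_sum]
  have drop_sum : ((ν.parts.sort (· ≥ ·)).drop μ.parts.card).sum = 0 := by
    have := h μ.parts.card
    omega
  have drop_eq_nil : (ν.parts.sort (· ≥ ·)).drop μ.parts.card = [] :=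
    List.eq_nil_iff_forall_not_mem.2 fun x hx =>
      (ν.parts_pos ((Multiset.mem_sort _).1 (List.mem_of_mem_drop hx))).ne'
        (List.sum_eq_zero_iff.1 drop_sum x hx)
  simpa using List.drop_eq_nil_iff.1 drop_eq_nil

theorem DomLE.antisymm (h : DomLE μ ν) (h' : DomLE ν μ) : μ = ν := by
  have hcard : μ.parts.card = ν.parts.card := le_antisymm h'.card_parts_le h.card_parts_le
  have e : μ.parts.sort (· ≥ ·) = ν.parts.sort (· ≥ ·) :=
    List.eq_of_sum_take_eq (by simpa using hcard) fun k _ => le_antisymm (h k) (h' k)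
  ext1
  rw [← Multiset.sort_eq μ.parts (· ≥ ·), e, Multiset.sort_eq]

end Dominance

section SumPair

variable {σ M : Type*} [DecidableEq σ] [AddCommMonoid M] {i j : σ}

theorem sum_eq_sum_sdiff_pair_add (hij : i ≠ j) (x : σ → M) (T : Finset σ) :
    ∑ k ∈ T, x k = ∑ k ∈ T \ {i, j}, x k +
      ((if i ∈ T then x i else 0) + if j ∈ T then x j else 0) := by
  rw [← Finset.sum_inter_add_sum_sdiff T {i, j}, add_comm, Finset.inter_comm,
    ← Finset.sum_ite_mem, Finset.sum_pair hij]

theorem sum_sdiff_pair_congr {x y : σ → M} (h : ∀ k, k ≠ i → k ≠ j → x k = y k) (T : Finset σ) :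
    ∑ k ∈ T \ {i, j}, x k = ∑ k ∈ T \ {i, j}, y k := by
  refine Finset.sum_congr rfl fun k hk => ?_
  simp only [Finset.mem_sdiff, Finset.mem_insert, Finset.mem_singleton, not_or] at hk
  exact h k hk.2.1 hk.2.2

end SumPair

section HasType

variable {σ : Type*} [Fintype σ] {n : ℕ} {μ ν : n.Partition} {a b : σ → ℕ} {i j : σ}

/-- The nonzero entries of the exponent vector `a` are the parts of `μ`. -/
def HasType (a : σ → ℕ) (μ : n.Partition) : Prop :=
  (Finset.univ.val.map a).filter (· ≠ 0) = μ.parts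

theorem exists_hasType (ha : ∑ i, a i = n) : ∃ μ : n.Partition, HasType a μ :=
  ⟨Nat.Partition.ofSums n (Finset.univ.val.map a) ha, rfl⟩

theorem hasType_toPartition {N : ℕ} (lam : Fin N → ℕ) : HasType lam (toPartition lam) := rfl

theorem HasType.unique (hμ : HasType a μ) (hν : HasType a ν) : μ = ν :=
  Nat.Partition.ext (hμ.symm.trans hν)

theorem HasType.comp_perm (h : HasType a μ) (e : Equiv.Perm σ) : HasType (a ∘ e) μ := by
  rwa [HasType, ← Multiset.map_map, Multiset.map_univ_val_equiv]

theorem HasType.map_support (h : HasType a μ) :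
    (Finset.univ.filter (a · ≠ 0)).val.map a = μ.parts := by
  rw [← h, Multiset.filter_map]
  rfl

theorem HasType.sum_comp (h : HasType a μ) {M : Type*} [AddCommMonoid M] {f : ℕ → M}
    (hf : f 0 = 0) : ∑ i, f (a i) = (μ.parts.map f).sum := by
  rw [← h.map_support, Multiset.map_map]
  exact (Finset.sum_filter_of_ne (p := fun i => a i ≠ 0) fun i _ hi h₀ =>
    hi ((congrArg f h₀).trans hf)).symm

theorem HasType.sum_eq (h : HasType a μ) : ∑ i, a i = n := by
  simpa [μ.parts_sum] using h.sum_comp (f := id) rfl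

/-- The exponent vector `a` of degree `n`, once sorted, is dominated by `μ`. -/
def IsDominated (a : σ → ℕ) (μ : n.Partition) : Prop :=
  ∑ i, a i = n ∧ ∀ T : Finset σ, ∑ i ∈ T, a i ≤ partialSum μ T.card

theorem HasType.isDominated_iff (h : HasType a μ) : IsDominated a ν ↔ DomLE μ ν := by
  constructor
  · intro ha k
    obtain ⟨s, hs, hc, he⟩ := exists_sum_eq_partialSum μ k
    obtain ⟨u, hu, rfl⟩ := exists_le_map_eq a _ ((h ▸ hs).trans (Multiset.filter_le _ _))
    rw [← he]
    exact (ha.2 ⟨u, Multiset.nodup_of_le hu Finset.univ.nodup⟩).trans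
      (partialSum_mono _ (by simpa using hc))
  · refine fun hμ => ⟨h.sum_eq, fun T => le_trans ?_ (hμ T.card)⟩
    have hle : (T.filter (a · ≠ 0)).val.map a ≤ μ.parts := h.map_support ▸ Multiset.map_le_map
      (Finset.val_le_iff.2 (Finset.filter_subset_filter _ (Finset.subset_univ T)))
    have hcard : ((T.filter (a · ≠ 0)).val.map a).card ≤ T.card :=
      (Multiset.card_map _ _).trans_le (Finset.card_filter_le _ _)
    exact (Finset.sum_filter_ne_zero T).symm.trans_le (sum_le_partialSum μ hle hcard)

theorem HasType.isDominated (h : HasType a μ) : IsDominated a μ :=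
  h.isDominated_iff.2 (DomLE.refl μ)

theorem IsDominated.comp_perm (h : IsDominated a μ) (e : Equiv.Perm σ) : IsDominated (a ∘ e) μ :=
  ⟨(Equiv.sum_comp e a).trans h.1, fun T => by simpa using h.2 (T.map e.toEmbedding)⟩

theorem IsDominated.of_move (hij : i ≠ j) (hb : ∀ k, k ≠ i → k ≠ j → b k = a k)
    (hs : b i + b j = a i + a j) (hm : max (b i) (b j) ≤ max (a i) (a j))
    (ha : IsDominated a μ) : IsDominated b μ := by
  classical
  have swap_apply (k : σ) (hi : k ≠ i) (hj : k ≠ j) : (a ∘ Equiv.swap i j) k = a k :=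
    congrArg a (Equiv.swap_apply_of_ne_of_ne hi hj)
  refine ⟨?_, fun T => ?_⟩
  · rw [← ha.1, sum_eq_sum_sdiff_pair_add hij, sum_eq_sum_sdiff_pair_add hij a,
      sum_sdiff_pair_congr hb]
    simpa using hs
  · have le_max : ∑ k ∈ T, b k ≤ max (∑ k ∈ T, a k) (∑ k ∈ T, (a ∘ Equiv.swap i j) k) := by
      rw [sum_eq_sum_sdiff_pair_add hij, sum_eq_sum_sdiff_pair_add hij a,
        sum_eq_sum_sdiff_pair_add hij (a ∘ Equiv.swap i j), sum_sdiff_pair_congr hb,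
        sum_sdiff_pair_congr swap_apply, Function.comp_apply, Function.comp_apply,
        Equiv.swap_apply_left, Equiv.swap_apply_right]
      split_ifs <;> omega
    exact le_max.trans (max_le (ha.2 T) ((ha.comp_perm _).2 T))

theorem HasType.not_isDominated_of_move (h : HasType b μ) (hij : i ≠ j)
    (hb : ∀ k, k ≠ i → k ≠ j → b k = a k) (hs : b i + b j = a i + a j)
    (hm : max (b i) (b j) < max (a i) (a j)) : ¬ IsDominated a μ := by
  classical
  intro ha
  obtain ⟨ν, hν⟩ := exists_hasType ha.1
  obtain rfl : μ = ν := DomLE.antisymm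
    (h.isDominated_iff.1 (hν.isDominated.of_move hij hb hs hm.le)) (hν.isDominated_iff.1 ha)
  have sum_sq_eq : ∑ k, b k ^ 2 = ∑ k, a k ^ 2 :=
    (h.sum_comp (zero_pow two_ne_zero)).trans (hν.sum_comp (zero_pow two_ne_zero)).symm
  have sq_add_sq_eq : b i ^ 2 + b j ^ 2 = a i ^ 2 + a j ^ 2 := by
    rw [sum_eq_sum_sdiff_pair_add hij, sum_eq_sum_sdiff_pair_add hij (fun k => a k ^ 2),
      sum_sdiff_pair_congr fun k hi hj => by rw [hb k hi hj]] at sum_sq_eq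
    simpa using sum_sq_eq
  rcases max_cases (a i) (a j) with ⟨h, _⟩ | ⟨h, _⟩ <;> rw [h, max_lt_iff] at hm <;> nlinarith

end HasType

/-! ### Triangularity of the Dunkl operators -/

section DominatedSpan

variable {R σ : Type*} [CommRing R] [Fintype σ] {n : ℕ} {μ : n.Partition}
  {f g : MvPolynomial σ R} {i j : σ}

/-- The span of the monomials whose exponent vectors are dominated by `μ`. -/
def dominatedSpan (R σ : Type*) [CommRing R] [Fintype σ] {n : ℕ} (μ : n.Partition) :
    Submodule R (MvPolynomial σ R) :=
  restrictSupport R {a | IsDominated (a : σ → ℕ) μ}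

theorem mem_dominatedSpan_iff :
    f ∈ dominatedSpan R σ μ ↔ ∀ a : σ →₀ ℕ, coeff a f ≠ 0 → IsDominated a μ := by
  rw [dominatedSpan, mem_restrictSupport_iff]
  exact ⟨fun h a ha => h (mem_support_iff.2 ha), fun h a ha => h a (mem_support_iff.1 ha)⟩

theorem monomial_mem_dominatedSpan {a : σ →₀ ℕ} (ha : IsDominated a μ) (c : R) :
    monomial a c ∈ dominatedSpan R σ μ :=
  (monomial_mem_restrictSupport R).2 (Or.inl ha)

theorem coeff_rename_equiv {R σ τ : Type*} [CommSemiring R] (e : σ ≃ τ) (f : MvPolynomial σ R)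
    (b : τ →₀ ℕ) : coeff b (rename e f) = coeff (b.mapDomain e.symm) f := by
  rw [← coeff_rename_mapDomain e e.injective f, ← Finsupp.mapDomain_comp, Equiv.self_comp_symm,
    Finsupp.mapDomain_id]

theorem coe_mapDomain_symm {σ τ M : Type*} [AddCommMonoid M] (e : σ ≃ τ) (b : τ →₀ M) :
    ⇑(b.mapDomain e.symm) = b ∘ e :=
  funext fun i => by rw [Finsupp.mapDomain_equiv_apply, Equiv.symm_symm, Function.comp_apply]

theorem rename_mem_dominatedSpan (e : Equiv.Perm σ) (hf : f ∈ dominatedSpan R σ μ) :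
    rename e f ∈ dominatedSpan R σ μ := by
  rw [mem_dominatedSpan_iff] at hf ⊢
  intro b hb
  rw [coeff_rename_equiv] at hb
  have h := (hf _ hb).comp_perm e.symm
  rwa [coe_mapDomain_symm, Function.comp_assoc, Equiv.self_comp_symm, Function.comp_id] at h

/-- Moving a unit from the smaller entry `b i` to the larger entry `b j` leads out of the
dominated exponent vectors. -/
theorem coeff_X_mul_eq_zero {b : σ →₀ ℕ} (hb : HasType b μ) (hij : i ≠ j) (hle : b i ≤ b j)
    (hg : X j * g ∈ dominatedSpan R σ μ) : coeff b (X i * g) = 0 := by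
  classical
  rw [coeff_X_mul']
  split_ifs with hi
  swap
  · rfl
  by_contra hcoeff
  rw [← coeff_X_mul _ j] at hcoeff
  have hpos : b i ≠ 0 := Finsupp.mem_support_iff.1 hi
  refine hb.not_isDominated_of_move hij (fun k hki hkj => ?_) ?_ ?_
    (mem_dominatedSpan_iff.1 hg _ hcoeff)
  · simp [hki.symm, hkj.symm]
  · simp [hij, hij.symm]
    omega
  · simp [hij, hij.symm]
    omega

end DominatedSpan

section Triangular

variable {K : Type*} [Field K] {N n : ℕ} {μ : n.Partition} {i j : Fin N}
  {f : MvPolynomial (Fin N) K}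

theorem diffQuot_rename_swap (h : j ≠ i) (f : MvPolynomial (Fin N) K) :
    diffQuot K h (rename (Equiv.swap i j) f) = -diffQuot K h f := by
  apply mul_left_cancel₀ (X_sub_X_ne_zero (K := K) h)
  rw [mul_neg, mul_diffQuot, mul_diffQuot, rename_rename, ← Equiv.coe_trans, Equiv.swap_swap,
    Equiv.coe_refl, rename_id_apply, neg_sub]

theorem mapDomain_swap_eq_self {a : Fin N →₀ ℕ} (ha : a i = a j) :
    a.mapDomain (Equiv.swap i j) = a := by
  ext k
  rw [Finsupp.mapDomain_equiv_apply, Equiv.symm_swap]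
  exact Equiv.apply_swap_eq_self ha k

theorem X_mul_diffQuot_monomial (h : j ≠ i) {a : Fin N →₀ ℕ} (ha : a i = a j) (d : ℕ) :
    X i * diffQuot K h (monomial (a + Finsupp.single i d) 1) =
      ∑ t ∈ Finset.range d,
        monomial (a + (Finsupp.single i (t + 1) + Finsupp.single j (d - 1 - t))) 1 := by
  have symm : rename (Equiv.swap i j) (monomial a (1 : K)) = monomial a 1 := by
    rw [rename_monomial, mapDomain_swap_eq_self ha]
  have split : monomial (a + Finsupp.single i d) (1 : K) = X i ^ d * monomial a 1 := by
    rw [X_pow_eq_monomial, monomial_mul, mul_one, add_comm]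
  rw [split, diffQuot_X_pow_mul h d symm, Finset.sum_mul, Finset.mul_sum]
  refine Finset.sum_congr rfl fun t _ => ?_
  rw [← mul_assoc, ← mul_assoc, ← pow_succ', X_pow_eq_monomial, X_pow_eq_monomial, monomial_mul,
    monomial_mul, one_mul, one_mul, add_comm]

theorem exists_eq_add_single (i j : Fin N) (b : Fin N →₀ ℕ) :
    ∃ (a : Fin N →₀ ℕ) (d : ℕ), a i = a j ∧
      (b = a + Finsupp.single i d ∨ b = a + Finsupp.single j d) := by
  rcases eq_or_ne i j with rfl | hij
  · exact ⟨b, 0, rfl, by simp⟩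
  rcases le_total (b j) (b i) with h | h
  · refine ⟨b - Finsupp.single i (b i - b j), b i - b j, ?_,
      Or.inl (tsub_add_cancel_of_le (by simp)).symm⟩
    simp [hij]
    omega
  · refine ⟨b - Finsupp.single j (b j - b i), b j - b i, ?_,
      Or.inr (tsub_add_cancel_of_le (by simp)).symm⟩
    simp [hij]
    omega

theorem X_mul_diffQuot_monomial_mem_dominatedSpan (h : j ≠ i) {a : Fin N →₀ ℕ} (ha : a i = a j)
    {d : ℕ} (hd : IsDominated (a + Finsupp.single i d) μ) :
    X i * diffQuot K h (monomial (a + Finsupp.single i d) 1) ∈ dominatedSpan K (Fin N) μ := by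
  rw [X_mul_diffQuot_monomial h ha]
  refine Submodule.sum_mem _ fun t ht => monomial_mem_dominatedSpan ?_ _
  have ht := Finset.mem_range.1 ht
  refine hd.of_move h.symm (fun k hi hj => ?_) ?_ ?_
  · simp [hi.symm, hj.symm]
  · simp [h, h.symm]
    omega
  · simp [h, h.symm, ha]
    omega

theorem X_mul_diffQuot_mem_dominatedSpan (h : j ≠ i) (hf : f ∈ dominatedSpan K (Fin N) μ) :
    X i * diffQuot K h f ∈ dominatedSpan K (Fin N) μ := by
  suffices span_le : dominatedSpan K (Fin N) μ ≤
      (dominatedSpan K (Fin N) μ).comap (LinearMap.mulLeft K (X i) * diffQuot K h) from span_le hf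
  conv_lhs => rw [dominatedSpan, restrictSupport_eq_span]
  rw [Submodule.span_le]
  rintro _ ⟨b, hb, rfl⟩
  change X i * diffQuot K h (monomial b 1) ∈ dominatedSpan K (Fin N) μ
  obtain ⟨a, d, ha, rfl | rfl⟩ := exists_eq_add_single i j b
  · exact X_mul_diffQuot_monomial_mem_dominatedSpan h ha hb
  · have swap_eq : monomial (a + Finsupp.single j d) (1 : K) =
        rename (Equiv.swap i j) (monomial (a + Finsupp.single i d) 1) := by
      rw [rename_monomial, Finsupp.mapDomain_add, mapDomain_swap_eq_self ha,
        Finsupp.mapDomain_single, Equiv.swap_apply_left]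
    have hd : IsDominated (a + Finsupp.single i d) μ := by
      refine hb.of_move h (fun k hj hi => ?_) ?_ ?_
      · simp [hi.symm, hj.symm]
      · simp [h, h.symm, ha]
        omega
      · simp [h, h.symm, ha]
    rw [swap_eq, diffQuot_rename_swap, mul_neg]
    exact Submodule.neg_mem _ (X_mul_diffQuot_monomial_mem_dominatedSpan h ha hd)

theorem coeff_X_mul_pderiv {R σ : Type*} [CommSemiring R] (i : σ) (f : MvPolynomial σ R)
    (b : σ →₀ ℕ) : coeff b (X i * pderiv i f) = b i * coeff b f := by
  classical
  induction f using MvPolynomial.induction_on' with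
  | add f g hf hg => rw [map_add, mul_add, coeff_add, hf, hg, coeff_add, mul_add]
  | monomial a c =>
    rw [X_mul_pderiv_monomial, coeff_smul, coeff_monomial, nsmul_eq_mul]
    split_ifs with h
    · rw [h]
    · simp

theorem xDunkl_mem_dominatedSpan (θ : K) (i : Fin N) (hf : f ∈ dominatedSpan K (Fin N) μ) :
    xDunkl θ i f ∈ dominatedSpan K (Fin N) μ := by
  rw [xDunkl_apply]
  refine Submodule.add_mem _ ?_ (Submodule.smul_mem _ _ (Submodule.sum_mem _ fun j _ =>
    X_mul_diffQuot_mem_dominatedSpan j.2 hf))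
  rw [mem_dominatedSpan_iff] at hf ⊢
  intro a ha
  rw [coeff_X_mul_pderiv] at ha
  exact hf a (right_ne_zero_of_mul ha)

theorem xDunkl_add_smul_pow_mem_dominatedSpan (θ c : K) (i : Fin N) (m : ℕ)
    (hf : f ∈ dominatedSpan K (Fin N) μ) :
    ((xDunkl θ i + c • 1) ^ m) f ∈ dominatedSpan K (Fin N) μ :=
  Module.End.pow_apply_mem_of_forall_mem m (fun _ hg =>
    Submodule.add_mem _ (xDunkl_mem_dominatedSpan θ i hg) (Submodule.smul_mem _ _ hg)) f hf

theorem coeff_X_mul_diffQuot (h : j ≠ i) {b : Fin N →₀ ℕ} (hb : HasType b μ)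
    (hf : f ∈ dominatedSpan K (Fin N) μ) :
    coeff b (X i * diffQuot K h f) =
      if b j < b i then coeff b (f - rename (Equiv.swap i j) f) else 0 := by
  have mul_eq : X i * diffQuot K h f = f - rename (Equiv.swap i j) f + X j * diffQuot K h f := by
    rw [← mul_diffQuot h]
    ring
  have mem_left := X_mul_diffQuot_mem_dominatedSpan h hf
  have mem_right : X j * diffQuot K h f ∈ dominatedSpan K (Fin N) μ := by
    rw [← sub_eq_iff_eq_add'.2 mul_eq]
    exact Submodule.sub_mem _ mem_left
      (Submodule.sub_mem _ hf (rename_mem_dominatedSpan _ hf))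
  split_ifs with hlt
  · rw [mul_eq, coeff_add, coeff_X_mul_eq_zero hb h hlt.le mem_left, add_zero]
  · exact coeff_X_mul_eq_zero hb h.symm (not_lt.1 hlt) mem_right

theorem coeff_xDunkl (θ : K) (i : Fin N) {b : Fin N →₀ ℕ} (hb : HasType b μ)
    (hf : f ∈ dominatedSpan K (Fin N) μ) :
    coeff b (xDunkl θ i f) = b i * coeff b f +
      θ * ∑ j, if b j < b i then coeff b (f - rename (Equiv.swap i j) f) else 0 := by
  rw [xDunkl_apply, coeff_add, coeff_smul, coeff_sum, coeff_X_mul_pderiv, smul_eq_mul,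
    ← Finset.add_sum_erase _ _ (Finset.mem_univ i), if_neg (lt_irrefl _), zero_add]
  congr 2
  rw [Finset.sum_subtype (Finset.univ.erase i) (p := fun j => j ≠ i) (fun j => by simp)]
  exact Finset.sum_congr rfl fun j _ => coeff_X_mul_diffQuot j.2 hb hf

end Triangular

/-! ### Monomial symmetric polynomials -/

section Msymm

variable {σ R : Type*} [Fintype σ] [CommSemiring R] {n : ℕ} {μ ν : n.Partition}

theorem HasType.card_filter_eq {a b : σ → ℕ} (ha : HasType a μ) (hb : HasType b μ)
    (p : ℕ → Prop) [DecidablePred p] :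
    (Finset.univ.filter fun i => p (a i)).card = (Finset.univ.filter fun i => p (b i)).card := by
  have of_not_zero (q : ℕ → Prop) [DecidablePred q] (hq : ¬ q 0) :
      (Finset.univ.filter fun i => q (a i)).card = (Finset.univ.filter fun i => q (b i)).card := by
    simp only [Finset.card_filter]
    let indicator (x : ℕ) : ℕ := if q x then 1 else 0
    exact (ha.sum_comp (f := indicator) (if_neg hq)).trans
      (hb.sum_comp (f := indicator) (if_neg hq)).symm
  by_cases h₀ : p 0
  · have h := of_not_zero (fun x => ¬ p x) (not_not_intro h₀)
    have ha := Finset.card_filter_add_card_filter_not (s := Finset.univ) fun i => p (a i)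
    have hb := Finset.card_filter_add_card_filter_not (s := Finset.univ) fun i => p (b i)
    omega
  · exact of_not_zero p h₀

theorem HasType.exists_perm {a b : σ → ℕ} (ha : HasType a μ) (hb : HasType b μ) :
    ∃ e : Equiv.Perm σ, b ∘ e = a := by
  have card_fiber (y : ℕ) : Fintype.card {i // a i = y} = Fintype.card {i // b i = y} := by
    rw [Fintype.card_subtype, Fintype.card_subtype]
    exact ha.card_filter_eq hb (· = y)
  exact ⟨Equiv.ofFiberEquiv fun y => Fintype.equivOfCardEq (card_fiber y),
    funext fun i => Equiv.ofFiberEquiv_map _ i⟩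

theorem hasType_iff_map_support {a : σ →₀ ℕ} : HasType a μ ↔ a.support.val.map a = μ.parts := by
  have support_eq : a.support = Finset.univ.filter (a · ≠ 0) := by
    ext
    simp
  rw [HasType, Multiset.filter_map, support_eq]
  rfl

theorem hasType_mapDomain_iff {τ : Type*} [Fintype τ] {f : σ → τ} (hf : Function.Injective f)
    {a : σ →₀ ℕ} : HasType (a.mapDomain f) μ ↔ HasType a μ := by
  classical
  have map_eq : (a.support.val.map f).map (a.mapDomain f) = a.support.val.map a :=
    (Multiset.map_map _ _ _).trans
      (Multiset.map_congr rfl fun i _ => Finsupp.mapDomain_apply hf a i)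
  rw [hasType_iff_map_support, hasType_iff_map_support, Finsupp.mapDomain_support_of_injective hf,
    Finset.image_val_of_injOn hf.injOn, map_eq]

theorem coeff_eq_of_isSymmetric {f : MvPolynomial σ R} (hf : f.IsSymmetric) {a b : σ →₀ ℕ}
    (ha : HasType a μ) (hb : HasType b μ) : coeff a f = coeff b f := by
  obtain ⟨e, he⟩ := ha.exists_perm hb
  rw [← DFunLike.coe_injective ((coe_mapDomain_symm e b).trans he), ← coeff_rename_equiv, hf]

theorem prod_map_X {σ : Type*} [DecidableEq σ] (s : Multiset σ) :
    (s.map (X : σ → MvPolynomial σ R)).prod = monomial (Multiset.toFinsupp s) 1 := by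
  induction s using Multiset.induction_on with
  | empty => simp
  | cons i s ih =>
    rw [Multiset.map_cons, Multiset.prod_cons, ih, X, monomial_mul, mul_one,
      ← Multiset.singleton_add, map_add, Multiset.toFinsupp_singleton]

variable [DecidableEq σ]

theorem hasType_toFinsupp_iff {s : Sym σ n} :
    HasType (Multiset.toFinsupp s.1) μ ↔ .ofSym s = μ := by
  rw [hasType_iff_map_support, Nat.Partition.ext_iff, Multiset.toFinsupp_support,
    Multiset.toFinset_val]
  rfl

open Classical in
theorem coeff_msymm (μ : n.Partition) (a : σ →₀ ℕ) :
    coeff a (msymm σ R μ) = if HasType a μ then 1 else 0 := by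
  simp only [msymm, coeff_sum, prod_map_X, coeff_monomial]
  split_ifs with h
  · have card_eq : Multiset.card (Finsupp.toMultiset a) = n := by
      rw [Finsupp.card_toMultiset, ← h.sum_eq, Finsupp.sum_fintype _ _ fun _ => rfl]
      rfl
    have ofSym_eq : Nat.Partition.ofSym (Sym.mk (Finsupp.toMultiset a) card_eq) = μ :=
      hasType_toFinsupp_iff.1 (by rwa [Finsupp.toMultiset_toFinsupp])
    rw [Fintype.sum_eq_single ⟨Sym.mk (Finsupp.toMultiset a) card_eq, ofSym_eq⟩,
      if_pos (Finsupp.toMultiset_toFinsupp a)]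
    rintro ⟨s, hs⟩ hne
    exact if_neg fun e => hne (Subtype.ext (Subtype.ext (Multiset.toFinsupp_eq_iff.1 e)))
  · refine Fintype.sum_eq_zero _ fun s => if_neg ?_
    rintro rfl
    exact h (hasType_toFinsupp_iff.2 s.2)

theorem coeff_sum_smul_msymm (u : n.Partition → R) {a : σ →₀ ℕ} (ha : HasType a ν) :
    coeff a (∑ μ, u μ • msymm σ R μ) = u ν := by
  classical
  simp only [coeff_sum, coeff_smul, coeff_msymm]
  rw [Fintype.sum_eq_single ν fun μ hμ => ?_, if_pos ha, smul_eq_mul, mul_one]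
  rw [if_neg fun h => hμ (h.unique ha), smul_zero]

theorem map_msymm {S : Type*} [CommSemiring S] (φ : R →+* S) (μ : n.Partition) :
    MvPolynomial.map φ (msymm σ R μ) = msymm σ S μ := by
  classical
  ext a
  rw [coeff_map, coeff_msymm, coeff_msymm]
  split_ifs <;> simp

theorem msymm_isHomogeneous (μ : n.Partition) : (msymm σ R μ).IsHomogeneous n := by
  classical
  intro a ha
  rw [coeff_msymm] at ha
  have hμ : HasType a μ := by_contra fun h => ha (if_neg h)
  rw [Pi.one_def, ← Finsupp.degree_eq_weight_one, Finsupp.degree_eq_sum, hμ.sum_eq]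

theorem exists_eq_sum_msymm {f : MvPolynomial σ R} (hf : f.IsSymmetric) (hn : f.IsHomogeneous n) :
    ∃ u : n.Partition → R, f = ∑ μ, u μ • msymm σ R μ := by
  classical
  refine ⟨fun μ => if h : ∃ a : σ →₀ ℕ, HasType a μ then coeff h.choose f else 0, ?_⟩
  ext a
  by_cases ha : a.degree = n
  · obtain ⟨μ, hμ⟩ := exists_hasType ((Finsupp.degree_eq_sum a).symm.trans ha)
    have h : ∃ b : σ →₀ ℕ, HasType b μ := ⟨a, hμ⟩
    rw [coeff_sum_smul_msymm _ hμ, dif_pos h]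
    exact coeff_eq_of_isSymmetric hf hμ h.choose_spec
  · rw [hn.coeff_eq_zero ha, coeff_sum, Finset.sum_eq_zero fun μ _ => ?_]
    rw [coeff_smul, (msymm_isHomogeneous μ).coeff_eq_zero ha, smul_zero]

end Msymm

/-! ### Symmetric functions and symmetric polynomials -/

section ToVars

variable {K : Type*} [Field K]

theorem isHomogeneous_toVars (N : ℕ) {f : SymFn K} {n : ℕ} (hf : IsHomog f n) :
    (SymFn.toVars N f).IsHomogeneous n := by
  induction hf using IsWeightedHomogeneous.induction_on with
  | zero =>
    rw [map_zero]
    exact isHomogeneous_zero _ _ _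
  | add p q _ _ hp hq =>
    rw [map_add]
    exact hp.add hq
  | monomial d r hr =>
    rw [SymFn.toVars, aeval_monomial, algebraMap_eq, ← zero_add n, ← hr, Finsupp.weight_apply]
    refine (isHomogeneous_C _ _).mul (IsHomogeneous.prod _ _ _ fun k _ => ?_)
    have isHomogeneous_psum : (psum (Fin N) K k).IsHomogeneous k :=
      IsHomogeneous.sum _ _ _ fun i _ => by simpa using (isHomogeneous_X K i).pow k
    simpa [mul_comm] using isHomogeneous_psum.pow (d k)

theorem toVars_weightedHomogeneousComponent (N n : ℕ) (f : SymFn K) :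
    SymFn.toVars N (weightedHomogeneousComponent (fun k : ℕ+ => (k : ℕ)) n f) =
      homogeneousComponent n (SymFn.toVars N f) := by
  induction f using MvPolynomial.induction_on' with
  | add f g hf hg => simp only [map_add, hf, hg]
  | monomial d r =>
    have h : IsHomog (monomial d r : SymFn K) (Finsupp.weight (fun k : ℕ+ => (k : ℕ)) d) :=
      isWeightedHomogeneous_monomial _ _ _ rfl
    rw [weightedHomogeneousComponent_of_mem h,
      homogeneousComponent_of_mem (isHomogeneous_toVars N h)]
    split_ifs <;> simp

theorem map_toVars {L : Type*} [Field L] (φ : K →+* L) (N : ℕ) (f : SymFn K) :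
    MvPolynomial.map φ (SymFn.toVars N f) = SymFn.toVars N (MvPolynomial.map φ f) := by
  induction f using MvPolynomial.induction_on with
  | C c => simp [SymFn.toVars, algebraMap_eq]
  | add f g hf hg => simp only [map_add, hf, hg]
  | mul_X f k hf =>
    rw [map_mul, map_mul, hf, map_mul, map_mul, map_X, toVars_X, toVars_X]
    simp [psum]

section KillCompl

variable {M N : ℕ} (h : M ≤ N)

theorem killCompl_toVars (f : SymFn K) :
    killCompl (Fin.castLE_injective h) (SymFn.toVars N f) = SymFn.toVars M f := by
  suffices H : (killCompl (Fin.castLE_injective h)).comp (SymFn.toVars N) =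
      (SymFn.toVars M : SymFn K →ₐ[K] _) from congrArg (fun φ => φ f) H
  refine algHom_ext fun k => ?_
  rw [AlgHom.comp_apply, toVars_X, toVars_X, psum, psum, map_sum]
  symm
  refine Fintype.sum_of_injective _ (Fin.castLE_injective h) _ _ (fun i hi => ?_) fun i => ?_
  · rw [map_pow, killCompl, aeval_X, dif_neg hi, zero_pow k.ne_zero]
  · rw [map_pow, ← rename_X, killCompl_rename_app]

theorem killCompl_msymm {n : ℕ} (μ : n.Partition) :
    killCompl (Fin.castLE_injective h) (msymm (Fin N) K μ) = msymm (Fin M) K μ := by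
  classical
  ext a
  simp only [coeff_killCompl, coeff_msymm, hasType_mapDomain_iff (Fin.castLE_injective h)]

end KillCompl

theorem toVars_pDer_eq_zero {N n : ℕ} (hN : n ≤ N) {f : SymFn K} (hf : IsHomog f n)
    (h₀ : SymFn.toVars N f = 0) {l : ℕ} (hl : l < n) : SymFn.toVars N (pDer l f) = 0 := by
  refine congrFun (Matrix.eq_zero_of_forall_index_sum_pow_mul_eq_zero
    (f := fun i : Fin n => (X (Fin.castLE hN i) : MvPolynomial (Fin N) K))
    (v := fun l => SymFn.toVars N (pDer l f))
    (X_injective.comp (Fin.castLE_injective hN)) fun i => ?_) ⟨l, hl⟩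
  have h := X_mul_pderiv_toVars (Fin.castLE hN i) hf
  rw [h₀, map_zero, mul_zero, Finset.sum_range] at h
  simp only [pow_succ', mul_assoc, ← Finset.mul_sum] at h
  exact (mul_eq_zero.1 h.symm).resolve_left (X_ne_zero _)

variable [CharZero K]

theorem eq_C_of_pDer_eq_zero {f : SymFn K} (hf : ∀ l, pDer l f = 0) : f = C (coeff 0 f) := by
  classical
  ext d
  rw [coeff_C]
  split_ifs with hd
  · rw [hd]
  obtain ⟨k, hk⟩ := Finsupp.support_nonempty_iff.2 (Ne.symm hd)
  have pderiv_eq_zero : pderiv k f = 0 := by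
    have h := hf (k - 1)
    rw [pDer_apply, show ((k : ℕ) - 1).succPNat = k from PNat.eq (Nat.sub_add_cancel k.pos)] at h
    exact (smul_eq_zero.1 h).resolve_left (Nat.cast_add_one_ne_zero _)
  have h := congrArg (coeff (d - Finsupp.single k 1)) pderiv_eq_zero
  rw [coeff_pderiv, coeff_zero, tsub_add_cancel_of_le
    (Finsupp.single_le_iff.2 (Nat.one_le_iff_ne_zero.2 (Finsupp.mem_support_iff.1 hk)))] at h
  exact (mul_eq_zero.1 h).resolve_right (Nat.cast_add_one_ne_zero _)

theorem eq_zero_of_toVars_eq_zero {N n : ℕ} (hN : n ≤ N) {f : SymFn K} (hf : IsHomog f n)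
    (h₀ : SymFn.toVars N f = 0) : f = 0 := by
  induction n using Nat.strong_induction_on generalizing f with
  | _ n ih =>
    have hder (l : ℕ) : pDer l f = 0 := by
      rcases lt_or_ge l n with hl | hl
      · exact ih (n - (l + 1)) (by omega) (by omega) (hf.pDer (by omega))
          (toVars_pDer_eq_zero hN hf h₀ hl)
      · refine (pDer_apply l f).trans ?_
        rw [pderiv_eq_zero_of_notMem_vars, smul_zero]
        exact fun h => absurd (hf.le_of_mem_vars h) (by simpa using hl)
    have hC := eq_C_of_pDer_eq_zero hder
    rw [hC, SymFn.toVars, aeval_C, algebraMap_eq] at h₀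
    rw [hC, C_eq_zero.1 h₀, map_zero]

theorem toVars_ext {f g : SymFn K} (h : ∀ N, SymFn.toVars N f = SymFn.toVars N g) : f = g := by
  rw [← sub_eq_zero, ← finsum_weightedHomogeneousComponent (fun k : ℕ+ => (k : ℕ)) (f - g),
    finsum_eq_zero_of_forall_eq_zero]
  intro n
  refine eq_zero_of_toVars_eq_zero le_rfl
    (weightedHomogeneousComponent_isWeightedHomogeneous n (f - g)) ?_
  rw [toVars_weightedHomogeneousComponent, map_sub, h, sub_self, map_zero]

theorem esymm_mem_range_toVars (N k : ℕ) :
    esymm (Fin N) K k ∈ (SymFn.toVars N : SymFn K →ₐ[K] _).range := by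
  induction k using Nat.strong_induction_on with
  | _ k ih =>
    rcases Nat.eq_zero_or_pos k with rfl | hk
    · rw [esymm_zero]
      exact Subalgebra.one_mem _
    have neg_one_pow_mem (l : ℕ) :
        (-1 : MvPolynomial (Fin N) K) ^ l ∈ (SymFn.toVars N : SymFn K →ₐ[K] _).range :=
      Subalgebra.pow_mem _ (Subalgebra.neg_mem _ (Subalgebra.one_mem _)) l
    have natCast_mul_mem : (k : MvPolynomial (Fin N) K) * esymm (Fin N) K k ∈
        (SymFn.toVars N : SymFn K →ₐ[K] _).range := by
      rw [mul_esymm_eq_sum]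
      refine Subalgebra.mul_mem _ (neg_one_pow_mem _) (Subalgebra.sum_mem _ fun a ha => ?_)
      rw [Finset.mem_filter, Finset.HasAntidiagonal.mem_antidiagonal] at ha
      exact Subalgebra.mul_mem _ (Subalgebra.mul_mem _ (neg_one_pow_mem _) (ih _ ha.2))
        ⟨X ⟨a.2, by omega⟩, toVars_X _⟩
    rw [← nsmul_eq_mul, ← Nat.cast_smul_eq_nsmul K] at natCast_mul_mem
    have h := Subalgebra.smul_mem _ natCast_mul_mem ((k : K)⁻¹)
    rwa [inv_smul_smul₀ (Nat.cast_ne_zero.2 hk.ne')] at h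

theorem exists_toVars_eq (N : ℕ) {F : MvPolynomial (Fin N) K} (hF : F.IsSymmetric) :
    ∃ f : SymFn K, SymFn.toVars N f = F := by
  obtain ⟨g, hg⟩ := esymmAlgHom_fin_surjective K (le_refl N) ⟨F, hF⟩
  have aeval_esymm : aeval (fun i : Fin N => esymm (Fin N) K (i + 1)) g = F := by
    have h := congrArg Subtype.val hg
    rwa [esymmAlgHom_apply] at h
  choose e he using esymm_mem_range_toVars (K := K) N
  refine ⟨aeval (fun i : Fin N => e (i + 1)) g, ?_⟩
  rw [← aeval_esymm, ← AlgHom.comp_apply, comp_aeval]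
  congr 2
  ext i : 1
  exact he (i + 1)

theorem exists_isHomog_toVars_eq (N : ℕ) {n : ℕ} {F : MvPolynomial (Fin N) K}
    (hF : F.IsSymmetric) (hn : F.IsHomogeneous n) :
    ∃ f : SymFn K, IsHomog f n ∧ SymFn.toVars N f = F := by
  obtain ⟨f, rfl⟩ := exists_toVars_eq N hF
  refine ⟨_, weightedHomogeneousComponent_isWeightedHomogeneous n f, ?_⟩
  rw [toVars_weightedHomogeneousComponent, homogeneousComponent_of_mem hn, if_pos rfl]

end ToVars

/-! ### Monomial symmetric functions -/

section MonoSymm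

variable {K : Type*} [Field K] [CharZero K] {n : ℕ}

theorem exists_isMonomialSymm (μ : n.Partition) :
    ∃ g : SymFn K, IsHomog g n ∧ IsMonomialSymm μ g := by
  have lift_msymm (N : ℕ) : ∃ g : SymFn K, IsHomog g n ∧ SymFn.toVars N g = msymm (Fin N) K μ :=
    exists_isHomog_toVars_eq N (msymm_isSymmetric _ _ μ) (msymm_isHomogeneous μ)
  obtain ⟨g, hg, hgn⟩ := lift_msymm n
  refine ⟨g, hg, fun M => ?_⟩
  rcases le_total M n with h | h
  · rw [← killCompl_toVars h, hgn, killCompl_msymm]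
  · obtain ⟨g', hg', hgM⟩ := lift_msymm M
    have g_sub_eq_zero : g - g' = 0 := by
      refine eq_zero_of_toVars_eq_zero le_rfl (hg.sub hg') ?_
      rw [map_sub, hgn, ← killCompl_toVars h g', hgM, killCompl_msymm, sub_self]
    rw [sub_eq_zero.1 g_sub_eq_zero, hgM]

/-- The monomial symmetric function `m_μ`. -/
def monoSymm (K : Type*) [Field K] [CharZero K] {n : ℕ} (μ : n.Partition) : SymFn K :=
  (exists_isMonomialSymm μ).choose

theorem isHomog_monoSymm (μ : n.Partition) : IsHomog (monoSymm K μ) n :=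
  (exists_isMonomialSymm μ).choose_spec.1

theorem toVars_monoSymm (μ : n.Partition) (N : ℕ) :
    SymFn.toVars N (monoSymm K μ) = msymm (Fin N) K μ :=
  (exists_isMonomialSymm μ).choose_spec.2 N

theorem isMonomialSymm_iff {μ : n.Partition} {g : SymFn K} :
    IsMonomialSymm μ g ↔ g = monoSymm K μ :=
  ⟨fun h => toVars_ext fun N => (h N).trans (toVars_monoSymm μ N).symm,
    fun h => h ▸ toVars_monoSymm μ⟩

theorem map_monoSymm {L : Type*} [Field L] [CharZero L] (φ : K →+* L) (μ : n.Partition) :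
    MvPolynomial.map φ (monoSymm K μ) = monoSymm L μ :=
  isMonomialSymm_iff.1 fun N => by rw [← map_toVars, toVars_monoSymm, map_msymm]

theorem toVars_sum_smul_monoSymm (u : n.Partition → K) (N : ℕ) :
    SymFn.toVars N (∑ μ, u μ • monoSymm K μ) = ∑ μ, u μ • msymm (Fin N) K μ := by
  simp only [map_sum, map_smul, toVars_monoSymm]

theorem exists_exponent (ν : n.Partition) :
    ∃ (N : ℕ) (a : Fin N →₀ ℕ), HasType a ν := by
  refine ⟨ν.parts.toList.length, Finsupp.equivFunOnFinite.symm ν.parts.toList.get, ?_⟩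
  rw [HasType, Finsupp.coe_equivFunOnFinite_symm, Fin.univ_val_map, List.ofFn_get,
    Multiset.coe_toList]
  exact Multiset.filter_eq_self.2 fun x hx => (ν.parts_pos hx).ne'

theorem coeff_toVars_sum_smul_monoSymm (u : n.Partition → K) {N : ℕ} {a : Fin N →₀ ℕ}
    {ν : n.Partition} (ha : HasType a ν) :
    coeff a (SymFn.toVars N (∑ μ, u μ • monoSymm K μ)) = u ν := by
  rw [toVars_sum_smul_monoSymm, coeff_sum_smul_msymm u ha]

theorem linearIndependent_monoSymm (n : ℕ) :
    LinearIndependent K fun μ : n.Partition => monoSymm K μ := by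
  refine Fintype.linearIndependent_iff.2 fun u hu ν => ?_
  obtain ⟨N, a, ha⟩ := exists_exponent ν
  rw [← coeff_toVars_sum_smul_monoSymm u ha, hu, map_zero, coeff_zero]

theorem exists_eq_sum_monoSymm {f : SymFn K} (hf : IsHomog f n) :
    ∃ u : n.Partition → K, f = ∑ μ, u μ • monoSymm K μ := by
  obtain ⟨u, hu⟩ := exists_eq_sum_msymm (toVars_isSymmetric f) (isHomogeneous_toVars n hf)
  refine ⟨u, sub_eq_zero.1 (eq_zero_of_toVars_eq_zero le_rfl
    (hf.sub (IsWeightedHomogeneous.sum _ _ _ fun μ _ => (isHomog_monoSymm μ).smul (u μ))) ?_)⟩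
  rw [map_sub, toVars_sum_smul_monoSymm, hu, sub_self]

end MonoSymm

/-! ### Powers of the upper triangular matrix -/

section CompleteHomogeneous

variable {σ τ R : Type*} [CommRing R] [DecidableEq σ]

theorem aeval_hsymm [Fintype σ] (x : σ → R) (m : ℕ) :
    aeval x (hsymm σ R m) = ∑ s : Sym σ m, (s.1.map x).prod := by
  simp [hsymm, map_multiset_prod, Multiset.map_map]

theorem aeval_hsymm_equiv [Fintype σ] [Fintype τ] [DecidableEq τ] (e : σ ≃ τ) (x : τ → R) (m : ℕ) :
    aeval (x ∘ e) (hsymm σ R m) = aeval x (hsymm τ R m) := by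
  rw [← rename_hsymm σ R m e, aeval_rename]

theorem aeval_hsymm_option [Fintype σ] (x : Option σ → R) (m : ℕ) :
    aeval x (hsymm (Option σ) R (m + 1)) = x none * aeval x (hsymm (Option σ) R m) +
      aeval (x ∘ some) (hsymm σ R (m + 1)) := by
  rw [aeval_hsymm, aeval_hsymm, aeval_hsymm, ← Equiv.sum_comp symOptionSuccEquiv.symm,
    Fintype.sum_sum_type, Finset.mul_sum]
  congr 1 <;> refine Finset.sum_congr rfl fun s _ => ?_
  · change (((none ::ₛ s : Sym (Option σ) (m + 1)) : Multiset (Option σ)).map x).prod = _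
    rw [Sym.coe_cons, Multiset.map_cons, Multiset.prod_cons]
    rfl
  · change (((s.map Function.Embedding.some : Sym (Option σ) (m + 1)) :
      Multiset (Option σ)).map x).prod = _
    rw [Sym.coe_map, Multiset.map_map]
    rfl

/-- The complete homogeneous symmetric polynomial `h_m` in `(x_i)_{i ∈ s}`, zero for `m < 0`. -/
def hOn (x : σ → R) (s : Finset σ) (m : ℤ) : R :=
  if m < 0 then 0 else aeval (fun i : s => x i) (hsymm s R m.toNat)

variable (x : σ → R) (s : Finset σ)

theorem hOn_of_neg {m : ℤ} (hm : m < 0) : hOn x s m = 0 :=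
  if_pos hm

theorem hOn_natCast (m : ℕ) : hOn x s m = aeval (fun i : s => x i) (hsymm s R m) :=
  if_neg (Int.natCast_nonneg m).not_gt

theorem hOn_zero : hOn x s 0 = 1 := by
  simp [hOn]

theorem hOn_empty (m : ℕ) : hOn x ∅ (m + 1) = 0 := by
  exact_mod_cast (hOn_natCast x ∅ (m + 1)).trans
    ((aeval_hsymm _ _).trans (Finset.sum_of_isEmpty _))

variable {s} in
theorem hOn_insert {k : σ} (hk : k ∉ s) (m : ℤ) :
    hOn x (insert k s) m = x k * hOn x (insert k s) (m - 1) + hOn x s m := by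
  rcases lt_trichotomy m 0 with hm | rfl | hm
  · rw [hOn_of_neg x _ hm, hOn_of_neg x _ hm, hOn_of_neg x _ (by omega), mul_zero, add_zero]
  · rw [hOn_zero, hOn_zero, hOn_of_neg x _ (by omega), mul_zero, zero_add]
  · obtain ⟨m, rfl⟩ : ∃ k : ℕ, m = (k + 1 : ℕ) := ⟨(m - 1).toNat, by omega⟩
    let y : Option s → R := fun o => o.elim (x k) fun i => x i
    have x_eq_comp : (fun i : (insert k s : Finset σ) => x i) =
        y ∘ Finset.subtypeInsertEquivOption hk := by
      ext ⟨i, hi⟩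
      simp only [Function.comp_apply, Finset.subtypeInsertEquivOption, Equiv.coe_fn_mk, y]
      split_ifs with h
      · simp [h]
      · simp
    rw [show ((m + 1 : ℕ) : ℤ) - 1 = m by push_cast; ring, hOn_natCast, hOn_natCast, hOn_natCast,
      x_eq_comp, aeval_hsymm_equiv, aeval_hsymm_equiv, aeval_hsymm_option]
    rfl

end CompleteHomogeneous

section UpperMatrix

variable {ι R : Type*} [LinearOrder ι] [LocallyFiniteOrderTop ι]

theorem notMem_of_subset_Ioi {j : ι} {T : Finset ι} (hT : T ⊆ Finset.Ioi j) : j ∉ T :=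
  fun hj => (Finset.mem_Ioi.1 (hT hj)).false

theorem min'_insert_of_subset_Ioi {j : ι} {T : Finset ι} (hT : T ⊆ Finset.Ioi j) :
    (insert j T).min' (Finset.insert_nonempty j T) = j :=
  le_antisymm (Finset.min'_le _ _ (Finset.mem_insert_self j T)) <|
    Finset.le_min' _ _ _ fun _ hi => (Finset.mem_insert.1 hi).elim (fun h => h.ge)
      fun h => (Finset.mem_Ioi.1 (hT h)).le

theorem sum_powerset_eq_sum_min {M : Type*} [AddCommMonoid M] {A : Finset ι}
    (hA : ∀ j ∈ A, Finset.Ioi j ⊆ A) (F : Finset ι → M) :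
    ∑ T ∈ A.powerset, F T = F ∅ + ∑ j ∈ A, ∑ T ∈ (Finset.Ioi j).powerset, F (insert j T) := by
  rw [← Finset.add_sum_erase _ _ (Finset.empty_mem_powerset A), Finset.sum_sigma']
  congr 1
  have nonempty {T : Finset ι} (hT : T ∈ A.powerset.erase ∅) : T.Nonempty :=
    Finset.nonempty_iff_ne_empty.2 (Finset.ne_of_mem_erase hT)
  refine Finset.sum_bij' (fun T hT => ⟨T.min' (nonempty hT), T.erase (T.min' (nonempty hT))⟩)
    (fun p _ => insert p.1 p.2) (fun T hT => ?_) (fun p hp => ?_) (fun T hT => ?_) (fun p hp => ?_)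
    (fun T hT => ?_)
  · simp only [Finset.mem_sigma, Finset.mem_powerset]
    exact ⟨Finset.mem_powerset.1 (Finset.mem_of_mem_erase hT) (T.min'_mem (nonempty hT)),
      fun i hi => Finset.mem_Ioi.2 (Finset.min'_lt_of_mem_erase_min' T (nonempty hT) hi)⟩
  · rw [Finset.mem_sigma, Finset.mem_powerset] at hp
    exact Finset.mem_erase.2 ⟨Finset.insert_ne_empty _ _,
      Finset.mem_powerset.2 (Finset.insert_subset hp.1 (hp.2.trans (hA _ hp.1)))⟩
  · exact Finset.insert_erase (T.min'_mem (nonempty hT))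
  · obtain ⟨j, T⟩ := p
    have hT := Finset.mem_powerset.1 (Finset.mem_sigma.1 hp).2
    simp only [min'_insert_of_subset_Ioi hT, Finset.erase_insert (notMem_of_subset_Ioi hT)]
  · rw [Finset.insert_erase (T.min'_mem (nonempty hT))]

variable [CommRing R]

/-- The upper triangular matrix with diagonal `x` and all entries above the diagonal equal to
`c`. -/
def upperMatrix (c : R) (x : ι → R) : Matrix ι ι R :=
  Matrix.of fun i j => if i = j then x i else if i < j then c else 0

variable [Fintype ι] (c : R) (x : ι → R)

theorem upperMatrix_mulVec (v : ι → R) (k : ι) :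
    (upperMatrix c x).mulVec v k = x k * v k + c * ∑ j ∈ Finset.Ioi k, v j := by
  have entry_mul (j : ι) : upperMatrix c x k j * v j =
      (if k = j then x k * v k else 0) + if k < j then c * v j else 0 := by
    rw [upperMatrix, Matrix.of_apply]
    rcases lt_trichotomy k j with h | rfl | h
    · simp [h, h.ne]
    · simp
    · simp [h.ne', h.not_gt]
  simp only [Matrix.mulVec, dotProduct, entry_mul, Finset.sum_add_distrib]
  rw [Fintype.sum_ite_eq, ← Finset.sum_filter, ← Finset.mul_sum]
  congr 3
  ext
  simp

theorem upperMatrix_pow_mulVec_one (m : ℕ) (k : ι) :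
    (upperMatrix c x ^ m).mulVec (fun _ => 1) k =
      ∑ T ∈ (Finset.Ioi k).powerset, c ^ T.card * hOn x (insert k T) (m - T.card) := by
  induction m generalizing k with
  | zero =>
    rw [pow_zero, Matrix.one_mulVec, Finset.sum_eq_single_of_mem ∅ (Finset.empty_mem_powerset _)]
    · simp [hOn_zero]
    · intro T _ hT
      have := Finset.card_pos.2 (Finset.nonempty_iff_ne_empty.2 hT)
      rw [hOn_of_neg _ _ (by push_cast; omega), mul_zero]
  | succ m ih =>
    have sum_diagonal : ∑ T ∈ (Finset.Ioi k).powerset,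
        c ^ T.card * (x k * hOn x (insert k T) ((m + 1 : ℕ) - T.card - 1)) =
          x k * ∑ T ∈ (Finset.Ioi k).powerset, c ^ T.card * hOn x (insert k T) (m - T.card) := by
      rw [Finset.mul_sum]
      refine Finset.sum_congr rfl fun T _ => ?_
      rw [mul_left_comm, Nat.cast_succ, add_sub_right_comm, add_sub_cancel_right]
    have sum_above : ∑ T ∈ (Finset.Ioi k).powerset, c ^ T.card * hOn x T ((m + 1 : ℕ) - T.card) =
        c * ∑ j ∈ Finset.Ioi k, ∑ T ∈ (Finset.Ioi j).powerset,
          c ^ T.card * hOn x (insert j T) (m - T.card) := by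
      rw [sum_powerset_eq_sum_min fun j hj => Finset.Ioi_subset_Ioi (Finset.mem_Ioi.1 hj).le]
      simp only [Finset.card_empty, Nat.cast_zero, sub_zero, Nat.cast_succ, hOn_empty, mul_zero,
        zero_add, Finset.mul_sum]
      refine Finset.sum_congr rfl fun j _ => Finset.sum_congr rfl fun T hT => ?_
      rw [Finset.card_insert_of_notMem (notMem_of_subset_Ioi (Finset.mem_powerset.1 hT)), pow_succ',
        mul_assoc, Nat.cast_succ, add_sub_add_right_eq_sub]
    rw [pow_succ', ← Matrix.mulVec_mulVec, upperMatrix_mulVec]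
    simp only [ih]
    rw [← sum_diagonal, ← sum_above, ← Finset.sum_add_distrib]
    refine Finset.sum_congr rfl fun T hT => ?_
    rw [← mul_add, ← hOn_insert x (notMem_of_subset_Ioi (Finset.mem_powerset.1 hT))]

theorem one_dotProduct_upperMatrix_pow_mulVec_one (m : ℕ) :
    (fun _ => 1) ⬝ᵥ ((upperMatrix c x ^ m).mulVec fun _ => 1) =
      ∑ r ∈ Finset.Icc 1 (Fintype.card ι),
        c ^ (r - 1) * ∑ s ∈ Finset.powersetCard r Finset.univ, hOn x s (m + 1 - r) := by
  let F (s : Finset ι) : R := c ^ (s.card - 1) * hOn x s (m + 1 - s.card)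
  have F_empty : F ∅ = 0 := by
    simp [F, hOn_empty]
  have F_insert {j : ι} {T : Finset ι} (hT : T ⊆ Finset.Ioi j) :
      F (insert j T) = c ^ T.card * hOn x (insert j T) (m - T.card) := by
    simp only [F]
    rw [Finset.card_insert_of_notMem (notMem_of_subset_Ioi hT), add_tsub_cancel_right,
      Nat.cast_succ, add_sub_add_right_eq_sub]
  calc (fun _ => 1) ⬝ᵥ ((upperMatrix c x ^ m).mulVec fun _ => 1)
      = ∑ j, ∑ T ∈ (Finset.Ioi j).powerset, F (insert j T) := by
        simp only [dotProduct, one_mul, upperMatrix_pow_mulVec_one]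
        exact Finset.sum_congr rfl fun j _ => Finset.sum_congr rfl fun T hT =>
          (F_insert (Finset.mem_powerset.1 hT)).symm
    _ = ∑ s ∈ Finset.univ.powerset, F s := by
        rw [sum_powerset_eq_sum_min fun j _ => Finset.subset_univ _, F_empty, zero_add]
    _ = ∑ r ∈ Finset.range (Fintype.card ι + 1), ∑ s ∈ Finset.powersetCard r Finset.univ, F s := by
        rw [Finset.sum_powerset, Finset.card_univ]
    _ = ∑ r ∈ Finset.Icc 1 (Fintype.card ι), ∑ s ∈ Finset.powersetCard r Finset.univ, F s := by
        refine (Finset.sum_subset (fun r hr => ?_) fun r hr hr' => ?_).symm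
        · exact Finset.mem_range_succ_iff.2 (Finset.mem_Icc.1 hr).2
        · obtain rfl : r = 0 := by simp at hr hr'; omega
          rw [Finset.powersetCard_zero, Finset.sum_singleton, F_empty]
    _ = _ := by
        refine Finset.sum_congr rfl fun r _ => ?_
        rw [Finset.mul_sum]
        refine Finset.sum_congr rfl fun s hs => ?_
        rw [← (Finset.mem_powersetCard.1 hs).2]

end UpperMatrix

section Eigenvalue

variable {K : Type*} [Field K] {N : ℕ}

theorem hSub_eq_sum (x : Fin N → K) (r : ℕ) (m : ℤ) :
    hSub r m x = ∑ s ∈ Finset.powersetCard r Finset.univ, hOn x s m := by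
  rw [hSub]
  split_ifs with h
  · exact (Finset.sum_eq_zero fun s _ => if_pos h).symm
  · exact Finset.sum_congr rfl fun s _ => (if_neg h).symm

theorem eigMatrix_eq_upperMatrix (θ : K) (lam : Fin N → ℕ) :
    eigMatrix θ lam = upperMatrix (-θ) (ell θ lam) := rfl

theorem eig_eq_dotProduct (θ : K) (lam : Fin N → ℕ) (m : ℕ) :
    eig θ lam m = (fun _ => 1) ⬝ᵥ ((eigMatrix θ lam ^ m).mulVec fun _ => 1) := by
  rw [eigMatrix_eq_upperMatrix, one_dotProduct_upperMatrix_pow_mulVec_one, Fintype.card_fin, eig]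
  simp only [hSub_eq_sum]

end Eigenvalue

/-! ### Leading coefficients -/

section Leading

variable {K : Type*} [Field K] {N : ℕ} {lam : Fin N → ℕ} {i : Fin N}
  {f : MvPolynomial (Fin N) K} {c : Fin N → K}

/-- The coefficient of `x^{λ∘σ}` in `f` is `c (σ i)` for all permutations `σ`: it depends only on
the row of `λ` that is the exponent of `x_i`. -/
def HasOrbitCoeff (lam : Fin N → ℕ) (i : Fin N) (f : MvPolynomial (Fin N) K) (c : Fin N → K) :
    Prop :=
  ∀ σ : Equiv.Perm (Fin N), coeff (Finsupp.equivFunOnFinite.symm (lam ∘ σ)) f = c (σ i)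

theorem HasOrbitCoeff.congr (hc : HasOrbitCoeff lam i f c) {j k : Fin N} (hjk : lam j = lam k) :
    c j = c k := by
  have lam_comp_swap : lam ∘ Equiv.swap j k = lam := funext fun l => Equiv.apply_swap_eq_self hjk l
  have h := hc (Equiv.swap j k * Equiv.swap i j)
  rw [Equiv.Perm.coe_mul, ← Function.comp_assoc, lam_comp_swap, hc, Function.comp_apply,
    Equiv.swap_apply_left, Equiv.swap_apply_left] at h
  exact h

theorem HasOrbitCoeff.coeff_rename_swap (hc : HasOrbitCoeff lam i f c) (σ : Equiv.Perm (Fin N))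
    (j : Fin N) : coeff (Finsupp.equivFunOnFinite.symm (lam ∘ σ)) (rename (Equiv.swap i j) f) =
      c (σ j) := by
  have h := hc (σ * Equiv.swap i j)
  rw [Equiv.Perm.mul_apply, Equiv.swap_apply_left] at h
  rw [coeff_rename_equiv, ← h]
  exact congrArg (coeff · f) (DFunLike.coe_injective (coe_mapDomain_symm _ _))

theorem ell_eq_add_card_Ioi (θ : K) (lam : Fin N → ℕ) (k : Fin N) :
    ell θ lam k = lam k + θ * (Finset.Ioi k).card := by
  rw [ell, Fin.card_Ioi, Nat.sub_sub, add_comm 1, Nat.cast_sub k.2, Nat.cast_succ]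

theorem HasOrbitCoeff.map_xDunkl (hc : HasOrbitCoeff lam i f c) (hlam : Antitone lam) (θ : K)
    (hf : f ∈ dominatedSpan K (Fin N) (toPartition lam)) :
    HasOrbitCoeff lam i (xDunkl θ i f) ((eigMatrix θ lam).mulVec c) := by
  intro σ
  set b : Fin N →₀ ℕ := Finsupp.equivFunOnFinite.symm (lam ∘ σ)
  have summand (j : Fin N) :
      (if b j < b i then coeff b (f - rename (Equiv.swap i j) f) else 0) =
        if σ i < σ j then c (σ i) - c (σ j) else 0 := by
    rw [coeff_sub, hc.coeff_rename_swap, hc σ]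
    change (if lam (σ j) < lam (σ i) then _ else _) = _
    by_cases h : σ i < σ j
    · rw [if_pos h, ite_eq_left_iff]
      intro h'
      rw [hc.congr (le_antisymm (not_lt.1 h') (hlam h.le)), sub_self]
    · rw [if_neg h, if_neg (hlam (not_lt.1 h)).not_gt]
  calc coeff b (xDunkl θ i f)
      = lam (σ i) * c (σ i) + θ * ∑ j, if σ i < σ j then c (σ i) - c (σ j) else 0 := by
        rw [coeff_xDunkl θ i ((hasType_toPartition lam).comp_perm σ) hf, hc σ]
        simp only [summand]
        rfl
    _ = lam (σ i) * c (σ i) + θ * ∑ j ∈ Finset.Ioi (σ i), (c (σ i) - c j) := by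
        rw [Equiv.sum_comp σ fun j => if σ i < j then c (σ i) - c j else 0, ← Finset.sum_filter,
          Finset.filter_lt_eq_Ioi]
    _ = (eigMatrix θ lam).mulVec c (σ i) := by
        rw [eigMatrix_eq_upperMatrix, upperMatrix_mulVec, ell_eq_add_card_Ioi,
          Finset.sum_sub_distrib, Finset.sum_const, nsmul_eq_mul]
        ring

theorem HasOrbitCoeff.map_xDunkl_pow (hc : HasOrbitCoeff lam i f c) (hlam : Antitone lam) (θ : K)
    (hf : f ∈ dominatedSpan K (Fin N) (toPartition lam)) (m : ℕ) :
    HasOrbitCoeff lam i ((xDunkl θ i ^ m) f) ((eigMatrix θ lam ^ m).mulVec c) := by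
  induction m with
  | zero =>
    rw [pow_zero, pow_zero, Matrix.one_mulVec]
    exact hc
  | succ m ih =>
    have hm : (xDunkl θ i ^ m) f ∈ dominatedSpan K (Fin N) (toPartition lam) := by
      simpa using xDunkl_add_smul_pow_mem_dominatedSpan θ 0 i m hf
    rw [pow_succ', pow_succ', ← Matrix.mulVec_mulVec]
    exact ih.map_xDunkl hlam θ hm

theorem coeff_hpOp (hlam : Antitone lam) (θ : K)
    (hf : f ∈ dominatedSpan K (Fin N) (toPartition lam)) (hc : ∀ i, HasOrbitCoeff lam i f 1)
    (m : ℕ) : coeff (Finsupp.equivFunOnFinite.symm lam) (hpOp N θ m f) = eig θ lam m := by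
  rw [eig_eq_dotProduct, hpOp, LinearMap.sum_apply, coeff_sum]
  simp only [dotProduct, one_mul]
  exact Finset.sum_congr rfl fun i _ => (hc i).map_xDunkl_pow hlam θ hf m 1

theorem msymm_mem_dominatedSpan {R σ : Type*} [CommRing R] [Fintype σ] [DecidableEq σ] {n : ℕ}
    {μ ν : n.Partition} (h : DomLE μ ν) : msymm σ R μ ∈ dominatedSpan R σ ν := by
  classical
  rw [mem_dominatedSpan_iff]
  intro a ha
  rw [coeff_msymm] at ha
  have hμ : HasType a μ := by_contra fun h => ha (if_neg h)
  exact hμ.isDominated_iff.2 h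

theorem IsJackP.toVars_mem_dominatedSpan {θ : K} {n : ℕ} {ν : n.Partition} {P : SymFn K}
    (hP : IsJackP θ ν P) : SymFn.toVars N P ∈ dominatedSpan K (Fin N) ν := by
  obtain ⟨u, -, hu, huN⟩ := hP.triangular
  rw [huN]
  refine Submodule.sum_mem _ fun μ _ => ?_
  by_cases h : u μ = 0
  · rw [h, zero_smul]
    exact Submodule.zero_mem _
  · exact Submodule.smul_mem _ _ (msymm_mem_dominatedSpan (hu μ h))

theorem IsJackP.coeff_toVars {θ : K} {n : ℕ} {ν : n.Partition} {P : SymFn K} (hP : IsJackP θ ν P)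
    {a : Fin N →₀ ℕ} (ha : HasType a ν) : coeff a (SymFn.toVars N P) = 1 := by
  obtain ⟨u, hu, -, huN⟩ := hP.triangular
  rw [huN, coeff_sum_smul_msymm u ha, hu]

end Leading

/-! ### Jack symmetric functions -/

section LowerSpan

variable {K : Type*} [Field K] [CharZero K] {n : ℕ} {μ ν : n.Partition} {θ : K} {f : SymFn K}

/-- The span of the monomial symmetric functions `m_μ` with `μ ≺ ν`. -/
def lowerSpan (K : Type*) [Field K] [CharZero K] {n : ℕ} (ν : n.Partition) :
    Submodule K (SymFn K) :=
  Submodule.span K (monoSymm K '' {μ | DomLE μ ν ∧ μ ≠ ν})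

instance finiteDimensional_lowerSpan (ν : n.Partition) : FiniteDimensional K (lowerSpan K ν) :=
  FiniteDimensional.span_of_finite K (Set.toFinite _)

theorem monoSymm_mem_lowerSpan (h : DomLE μ ν) (hne : μ ≠ ν) : monoSymm K μ ∈ lowerSpan K ν :=
  Submodule.subset_span ⟨μ, ⟨h, hne⟩, rfl⟩

theorem lowerSpan_le_iff {W : Submodule K (SymFn K)} :
    lowerSpan K ν ≤ W ↔ ∀ μ, DomLE μ ν → μ ≠ ν → monoSymm K μ ∈ W := by
  rw [lowerSpan, Submodule.span_le, Set.image_subset_iff]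
  exact ⟨fun h μ hle hne => h ⟨hle, hne⟩, fun h μ hμ => h μ hμ.1 hμ.2⟩

theorem sub_smul_monoSymm_mem_lowerSpan_iff {c : K} :
    f - c • monoSymm K ν ∈ lowerSpan K ν ↔
      ∃ u : n.Partition → K, u ν = c ∧ (∀ μ, u μ ≠ 0 → DomLE μ ν) ∧
        f = ∑ μ, u μ • monoSymm K μ := by
  classical
  constructor
  · intro h
    obtain ⟨l, hl, hlf⟩ := (Finsupp.mem_span_image_iff_linearCombination K).1 h
    replace hl (μ) (hμ : l μ ≠ 0) : DomLE μ ν ∧ μ ≠ ν := hl (Finsupp.mem_support_iff.2 hμ)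
    have l_apply_self : l ν = 0 := by_contra fun h => (hl ν h).2 rfl
    refine ⟨l + Finsupp.single ν c, by simp [l_apply_self], fun μ hμ => ?_, ?_⟩
    · rcases eq_or_ne μ ν with rfl | hne
      · exact DomLE.refl μ
      · exact (hl μ (by simpa [hne.symm] using hμ)).1
    · rw [← sub_add_cancel f (c • monoSymm K ν), ← hlf, ← Finsupp.linearCombination_single,
        ← map_add, Finsupp.linearCombination_apply]
      exact Finsupp.sum_fintype _ _ fun μ => zero_smul K (monoSymm K μ)
  · rintro ⟨u, rfl, hu, rfl⟩
    rw [← Finset.add_sum_erase _ _ (Finset.mem_univ ν), add_sub_cancel_left]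
    refine Submodule.sum_mem _ fun μ hμ => ?_
    by_cases h : u μ = 0
    · rw [h, zero_smul]
      exact Submodule.zero_mem _
    · exact Submodule.smul_mem _ _ (monoSymm_mem_lowerSpan (hu μ h) (Finset.ne_of_mem_erase hμ))

theorem mem_orthogonal_lowerSpan_iff :
    f ∈ (hallForm θ).orthogonal (lowerSpan K ν) ↔
      ∀ μ, DomLE μ ν → μ ≠ ν → hall θ f (monoSymm K μ) = 0 := by
  have : f ∈ (hallForm θ).orthogonal (lowerSpan K ν) ↔ lowerSpan K ν ≤ (hallForm θ f).ker := by
    refine forall₂_congr fun g _ => ?_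
    rw [LinearMap.mem_ker, (hallForm_isSymm θ).eq]
  rw [this, lowerSpan_le_iff]
  rfl

theorem isJackP_iff : IsJackP θ ν f ↔
    f - monoSymm K ν ∈ lowerSpan K ν ∧ f ∈ (hallForm θ).orthogonal (lowerSpan K ν) := by
  have triangular_iff : f - monoSymm K ν ∈ lowerSpan K ν ↔
      ∃ u : n.Partition → K, u ν = 1 ∧ (∀ μ, u μ ≠ 0 → DomLE μ ν) ∧
        ∀ N : ℕ, SymFn.toVars N f = ∑ μ, u μ • msymm (Fin N) K μ := by
    rw [← one_smul K (monoSymm K ν), sub_smul_monoSymm_mem_lowerSpan_iff]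
    simp only [← toVars_sum_smul_monoSymm]
    exact exists_congr fun u => and_congr_right' (and_congr_right' ⟨fun h _ => h ▸ rfl, toVars_ext⟩)
  have orthogonal_iff : f ∈ (hallForm θ).orthogonal (lowerSpan K ν) ↔
      ∀ μ : n.Partition, DomLE μ ν → μ ≠ ν → ∀ g, IsMonomialSymm μ g → hall θ f g = 0 := by
    simp only [mem_orthogonal_lowerSpan_iff, isMonomialSymm_iff, forall_eq]
  rw [triangular_iff, orthogonal_iff]
  exact ⟨fun h => ⟨h.triangular, h.orthogonal⟩, fun h => ⟨h.1, h.2⟩⟩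

theorem IsJackP.isHomog (hf : IsJackP θ ν f) : IsHomog f n := by
  have h := (isJackP_iff.1 hf).1
  rw [← one_smul K (monoSymm K ν), sub_smul_monoSymm_mem_lowerSpan_iff] at h
  obtain ⟨u, -, -, rfl⟩ := h
  exact IsWeightedHomogeneous.sum _ _ _ fun μ _ => (isHomog_monoSymm μ).smul (u μ)

section BaseChange

variable {F : Type*} [Field F]

theorem map_gram_hallForm_monoSymm [CharZero F] {ι : Type*} (φ : F →+* K) (t : F)
    (p : ι → n.Partition) : (gram (hallForm t) fun i => monoSymm F (p i)).map φ =
      gram (hallForm (φ t)) fun i => monoSymm K (p i) := by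
  ext i j
  simp only [gram, Matrix.map_apply, Matrix.of_apply, hallForm_apply, map_hall, map_monoSymm]

theorem disjoint_lowerSpan_orthogonal [LinearOrder F] [IsStrictOrderedRing F] (φ : F →+* K) {t : F}
    (ht : 0 < t) (ν : n.Partition) :
    Disjoint (lowerSpan K ν) ((hallForm (φ t)).orthogonal (lowerSpan K ν)) := by
  classical
  have det_ne_zero :
      (gram (hallForm t) fun μ : {μ | DomLE μ ν ∧ μ ≠ ν} => monoSymm F μ.1).det ≠ 0 :=
    det_gram_ne_zero_of_anisotropic
      ((linearIndependent_monoSymm n).comp _ Subtype.val_injective)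
      fun f hf => (hall_self_pos ht hf).ne'
  rw [lowerSpan, Set.image_eq_range]
  refine disjoint_span_orthogonal_of_det_gram_ne_zero ?_
  rw [← map_gram_hallForm_monoSymm, ← RingHom.mapMatrix_apply, ← RingHom.map_det]
  exact (map_ne_zero φ).2 det_ne_zero

end BaseChange

theorem existsUnique_isJackP
    (hW : Disjoint (lowerSpan K ν) ((hallForm θ).orthogonal (lowerSpan K ν))) :
    ∃! f : SymFn K, IsJackP θ ν f := by
  simp only [isJackP_iff]
  exact existsUnique_sub_mem_and_mem_orthogonal hW _

end LowerSpan

section Eigenfunction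

variable {K : Type*} [Field K] [CharZero K] {n : ℕ} {μ ν : n.Partition} {θ : K}

theorem exists_hpSym_monoSymm_eq_sum (θ c : K) (m : ℕ) (μ : n.Partition) :
    ∃ u : n.Partition → K, (∀ ρ, u ρ ≠ 0 → DomLE ρ μ) ∧
      hpSym θ c n m (monoSymm K μ) = ∑ ρ, u ρ • monoSymm K ρ := by
  obtain ⟨u, hu⟩ := exists_eq_sum_monoSymm (isHomog_hpSym (θ := θ) (c := c) (m := m)
    (isHomog_monoSymm (K := K) μ))
  refine ⟨u, fun ρ hρ => ?_, hu⟩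
  obtain ⟨N, a, ha⟩ := exists_exponent ρ
  have mem : SymFn.toVars N (hpSym θ c n m (monoSymm K μ)) ∈ dominatedSpan K (Fin N) μ := by
    rw [toVars_hpSym θ c n m (isHomog_monoSymm μ), toVars_monoSymm]
    exact Submodule.sum_mem _ fun i _ => xDunkl_add_smul_pow_mem_dominatedSpan θ _ i m
      (xDunkl_mem_dominatedSpan θ i (msymm_mem_dominatedSpan (DomLE.refl μ)))
  refine ha.isDominated_iff.1 (mem_dominatedSpan_iff.1 mem a ?_)
  rwa [hu, coeff_toVars_sum_smul_monoSymm u ha]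

theorem hpSym_mem_lowerSpan (θ c : K) (m : ℕ) {f : SymFn K} (hf : f ∈ lowerSpan K ν) :
    hpSym θ c n m f ∈ lowerSpan K ν := by
  suffices lowerSpan K ν ≤ (lowerSpan K ν).comap (hpSym θ c n m) from this hf
  refine lowerSpan_le_iff.2 fun μ hle hne => ?_
  obtain ⟨u, hu, hu'⟩ := exists_hpSym_monoSymm_eq_sum θ c m μ
  have u_apply : u ν = 0 := by_contra fun h => hne (hle.antisymm (hu ν h))
  have h := sub_smul_monoSymm_mem_lowerSpan_iff.2
    ⟨u, u_apply, fun ρ hρ => (hu ρ hρ).trans hle, hu'⟩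
  rwa [zero_smul, sub_zero] at h

theorem IsJackP.exists_hpSym_eq_smul (hθ : θ ≠ 0)
    (hW : Disjoint (lowerSpan K ν) ((hallForm θ).orthogonal (lowerSpan K ν))) (c : K) (m : ℕ)
    {f : SymFn K} (hf : IsJackP θ ν f) : ∃ e : K, hpSym θ c n m f = e • f := by
  obtain ⟨u, hu, hu'⟩ := exists_hpSym_monoSymm_eq_sum θ c m ν
  obtain ⟨sub_mem, mem_orthogonal⟩ := isJackP_iff.1 hf
  exact ⟨u ν, apply_eq_smul_of_mem_orthogonal (isSelfAdjoint_hpSym hθ c n m) hW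
    (fun g => hpSym_mem_lowerSpan θ c m)
    (sub_smul_monoSymm_mem_lowerSpan_iff.2 ⟨u, rfl, hu, hu'⟩) sub_mem mem_orthogonal⟩

end Eigenfunction

/-! ### Specialization of the parameter -/

section Parameter

open IntermediateField

theorem exists_pos_transcendental_rat : ∃ r : ℝ, 0 < r ∧ Transcendental ℚ r := by
  refine ⟨liouvilleNumber 2, ?_, ?_⟩
  · exact (LiouvilleNumber.summable one_lt_two).tsum_pos (fun _ => by positivity) 0 (by norm_num)
  · exact (IsFractionRing.isAlgebraic_iff ℤ ℚ ℝ).not.1 (transcendental_liouvilleNumber le_rfl)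

theorem exists_algHom_adjoin_simple_of_transcendental {k E L : Type*} [Field k] [Field E] [Field L]
    [Algebra k E] [Algebra k L] {x : E} {y : L} (hx : Transcendental k x)
    (hy : Transcendental k y) : ∃ φ : k⟮x⟯ →ₐ[k] L, φ (AdjoinSimple.gen k x) = y := by
  refine ⟨k⟮y⟯.val.comp ((RatFunc.algEquivOfTranscendental x hx).symm.trans
    (RatFunc.algEquivOfTranscendental y hy) : k⟮x⟯ →ₐ[k] k⟮y⟯), ?_⟩
  simp [RatFunc.algEquivOfTranscendental_symm_gen]

theorem exists_ringHom_of_transcendental_or_pos {K : Type*} [Field K] [Algebra ℂ K] {θ : K}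
    (hθ : Transcendental ℂ θ ∨ ∃ t : ℝ, 0 < t ∧ θ = algebraMap ℂ K t) :
    ∃ (F : Subfield ℝ) (φ : F →+* K) (t : F), 0 < t ∧ φ t = θ := by
  rcases hθ with hθ | ⟨t, ht, rfl⟩
  · have : CharZero K := charZero_of_injective_algebraMap (algebraMap ℂ K).injective
    obtain ⟨r, hr, r_transcendental⟩ := exists_pos_transcendental_rat
    obtain ⟨φ, hφ⟩ := exists_algHom_adjoin_simple_of_transcendental r_transcendental
      (hθ.restrictScalars (algebraMap ℚ ℂ).injective)
    exact ⟨ℚ⟮r⟯.toSubfield, φ.toRingHom, AdjoinSimple.gen ℚ r, hr, hφ⟩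
  · exact ⟨⊤, (algebraMap ℂ K).comp (Complex.ofRealHom.comp (Subfield.subtype ⊤)),
      ⟨t, Subfield.mem_top t⟩, ht, rfl⟩

end Parameter

/-! ### Jack polynomials -/

section JackPolynomials

variable {N : ℕ}

theorem IsJackP.hpOp_toVars {K : Type*} [Field K] [CharZero K] {θ : K} (hθ : θ ≠ 0)
    {lam : Fin N → ℕ} (hlam : Antitone lam)
    (hW : Disjoint (lowerSpan K (toPartition lam))
      ((hallForm θ).orthogonal (lowerSpan K (toPartition lam))))
    {f : SymFn K} (hf : IsJackP θ (toPartition lam) f) (m : ℕ) :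
    hpOp N θ m (SymFn.toVars N f) = eig θ lam m • SymFn.toVars N f := by
  have exists_eigenvalue : ∃ e : K, hpOp N θ m (SymFn.toVars N f) = e • SymFn.toVars N f := by
    cases m with
    | zero => exact ⟨N, by simp [hpOp, Nat.cast_smul_eq_nsmul]⟩
    | succ m =>
      obtain ⟨e, he⟩ := hf.exists_hpSym_eq_smul hθ hW (N : K) m
      exact ⟨e, by rw [← toVars_hpSym_self θ _ m hf.isHomog, he, map_smul]⟩
  obtain ⟨e, he⟩ := exists_eigenvalue
  have coeff_one : ∀ i, HasOrbitCoeff lam i (SymFn.toVars N f) 1 :=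
    fun _ σ => hf.coeff_toVars ((hasType_toPartition lam).comp_perm σ)
  have eig_eq := coeff_hpOp hlam θ hf.toVars_mem_dominatedSpan coeff_one m
  rw [he, coeff_smul, hf.coeff_toVars (hasType_toPartition lam), smul_eq_mul, mul_one] at eig_eq
  rw [he, eig_eq]

theorem jackFactor_pos {F : Type*} [Field F] [LinearOrder F] [IsStrictOrderedRing F] {t : F}
    (ht : 0 < t) (lam : Fin N → ℕ) : 0 < jackFactor t lam := by
  refine Finset.prod_pos fun i _ => Finset.prod_pos fun j hj => ?_
  have arm_nonneg : (0 : F) ≤ (lam i : F) - j - 1 := by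
    rw [sub_sub, sub_nonneg]
    exact_mod_cast Finset.mem_range.1 hj
  positivity

theorem map_jackFactor {F K : Type*} [Field F] [Field K] (φ : F →+* K) (t : F)
    (lam : Fin N → ℕ) : φ (jackFactor t lam) = jackFactor (φ t) lam := by
  simp only [jackFactor, map_prod, map_add, map_div₀, map_sub, map_natCast, map_one]

end JackPolynomials

end HeckmanPolychronakos

end

open HeckmanPolychronakos MvPolynomial in
theorem theorem3p1_general {F K : Type*} [Field F] [LinearOrder F] [IsStrictOrderedRing F]
    [Field K] (φ : F →+* K) {t : F} (ht : 0 < t) {N : ℕ} {lam : Fin N → ℕ}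
    (hlam : Antitone lam) :
    (∃! P : SymFn K, IsJackP (φ t) (toPartition lam) P) ∧
    jackJ (φ t) lam ≠ 0 ∧
    ∀ m : ℕ,
      hpOp N (φ t) m (jackJ (φ t) lam) = eig (φ t) lam m • jackJ (φ t) lam ∧
      eig (φ t) lam m =
        (fun _ => 1) ⬝ᵥ ((eigMatrix (φ t) lam ^ m).mulVec fun _ => 1) := by
  have : CharZero K := charZero_of_injective_ringHom φ.injective
  have hφt : φ t ≠ 0 := (map_ne_zero φ).2 ht.ne'
  have hW := disjoint_lowerSpan_orthogonal φ ht (toPartition lam)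
  have hex := existsUnique_isJackP hW
  have hP : IsJackP (φ t) (toPartition lam) (jackP (φ t) (toPartition lam)) :=
    Classical.epsilon_spec hex.exists
  have factor_ne_zero : jackFactor (φ t) lam ≠ 0 := by
    rw [← map_jackFactor]
    exact (map_ne_zero φ).2 (jackFactor_pos ht lam).ne'
  have toVars_ne_zero : SymFn.toVars N (jackP (φ t) (toPartition lam)) ≠ 0 := fun h => by
    have coeff_one := hP.coeff_toVars (a := Finsupp.equivFunOnFinite.symm lam)
      (hasType_toPartition lam)
    exact zero_ne_one (h ▸ coeff_one)
  refine ⟨hex, smul_ne_zero factor_ne_zero toVars_ne_zero, fun m => ⟨?_, eig_eq_dotProduct _ lam m⟩⟩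
  rw [jackJ, map_smul, hP.hpOp_toVars hφt hlam hW, smul_comm]

open HeckmanPolychronakos in
theorem theorem3p1 {K : Type*} [Field K] [Algebra ℂ K] (θ : K)
    (hθ : Transcendental ℂ θ ∨ ∃ t : ℝ, 0 < t ∧ θ = algebraMap ℂ K (t : ℂ))
    (N : ℕ) (hN : 1 ≤ N) (lam : Fin N → ℕ) (hlam : Antitone lam) :
    (∃! P : SymFn K, IsJackP θ (toPartition lam) P) ∧
    jackJ θ lam ≠ 0 ∧
    ∀ m : ℕ, 1 ≤ m →
      hpOp N θ m (jackJ θ lam) = eig θ lam m • jackJ θ lam ∧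
      eig θ lam m = (fun _ => 1) ⬝ᵥ ((eigMatrix θ lam ^ m).mulVec fun _ => 1) := by
  obtain ⟨F, φ, t, ht, rfl⟩ := exists_ringHom_of_transcendental_or_pos hθ
  obtain ⟨existsUnique, jack_ne_zero, eigen⟩ := theorem3p1_general φ ht hlam
  exact ⟨existsUnique, jack_ne_zero, fun m _ => eigen m⟩
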